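/- \textbf{Setting.} A generator is a family of functions $G_n:\{0,1\}^n\times\mathbb N\to\{0,1\}$; $G_n(x,i)$ is the $i$-th bit ($i=0,1,2,\dots$) generated from the seed $x$. The seed $X$ is uniform on $\{0,1\}^n$. Entropies are Shannon entropies in bits, and algorithms are (uniform) quantum algorithms with classical input and output, of which probabilistic algorithms are a special case. Let $p$ be a polynomial with natural coefficients. For $I\subseteq\{0,\dots,8p(n)-1\}$ with $|I|=p(n)$ let $X_I=(G_n(X,i))_{i\in I}$, a not necessarily contiguous subsequence of $p(n)$ generated bits. (i) $G$ is \emph{attackable from $p(n)$ bits} if there are a quantum polynomial-time algorithm $P$ and a constant $C$ such that, for all $n$ and all such $I$, the output of $P$ on input $(1^n,X_I,I)$ satisfies $H(X\mid P(1^n,X_I,I))\le C\,2^{-n}$. (ii) The seed of $G$ is \emph{computable from $p(n)$ bits} if there are a quantum polynomial-time algorithm $P$ and a constant $C$ such that, for all $n$ and all such $I$, $\Pr[P(1^n,X_I,I)=X]\ge 1-C\,2^{-n}$. \textbf{Scheme.} Messages are elements of $\mathcal M_n=\{0,1\}^{\ell(n)}$, tags are elements of $\mathcal T_n=\{0,\dots,t(n)-1\}$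 with $t(n)\ge 2$, $k(n)=\lceil\log_2 t(n)\rceil$, and $\mathcal H_n$ is a set of hash functions $\mathcal M_n\to\mathcal T_n$. Alice and Bob share $h\in\mathcal H_n$ and the seed $X$. For each message $Y$ in turn, Alice publicly sends $Y$ and encodes each of the $k(n)$ bits of the binary representation of the tag $h(Y)$ in one qubit, using the next bit generated from the seed $X$: a tag bit $0$ or $1$ is encoded as $|0\rangle$ or $|1\rangle$ if the generated bit is $0$, and as $|+\rangle$ or $|-\rangle$ if it is $1$. An adversary who observes $N$ tags gets $1^n$, $1^{\ell(n)}$, $1^{k(n)}$, $1^N$, the messages $Y_0,\dots,Y_{N-1}$, the $Nk(n)$ qubits that encode their tags, and oracle access to $h$. \textbf{Corollary.} For every scheme of this kind, the following holds. 1. If $G$ is attackable from $p(n)$ bits, there are a quantum adversary $E$ running in time polynomial in $n+N+\ell(n)+k(n)$ and constants $C$, $c>0$ such that, for all $n$, all $N$ with $N\,k(n)\ge 8p(n)$, all $h\in\mathcal H_n$ and all messages $Y_0,\dots,Y_{N-1}$, the output $E$ of the adversary satisfies $H(X\mid E)\le C\,2^{-cn}$. 2. If the seed of $G$ is computable from $p(n)$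 bits, there are a quantum adversary $E$ running in time polynomial in $n+N+\ell(n)+k(n)$ and constants $C$, $c>0$ such that, for the same $n,N,h,Y_0,\dots,Y_{N-1}$, the output of the adversary satisfies $\Pr[E=X]\ge 1-C\,2^{-cn}$. So, if the generator is attackable, the scheme is not polynomial-time secure against a quantum adversary who has access to $h$: the secret seed leaks. -/

import Mathlib

open scoped BigOperators

/-! # Quantum memory -/

/-- A (not necessarily normalised) pure state of a countable row of qubits, all but finitely many of
which are in state `|0⟩`.  The basis vector labelled by the finite set `s` is the one in which exactly
the qubits in `s` are in state `|1⟩`. -/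
abbrev QState : Type := Finset ℕ →₀ ℂ

/-- The state `|00…⟩`. -/
noncomputable def QState.zero : QState := Finsupp.single ∅ 1

/-- Squared Euclidean norm. -/
noncomputable def QState.normSq (ψ : QState) : ℝ := ψ.sum fun _ z => ‖z‖ ^ 2

/-- Linear extension of a map given on basis vectors. -/
noncomputable def QState.lift (f : Finset ℕ → QState) : QState →ₗ[ℂ] QState :=
  Finsupp.linearCombination ℂ f

/-- Bit flip of qubit `i`. -/
noncomputable def QState.gateX (i : ℕ) : QState →ₗ[ℂ] QState :=
  QState.lift fun s => Finsupp.single (symmDiff s {i}) 1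

/-- Hadamard gate on qubit `i`. -/
noncomputable def QState.gateH (i : ℕ) : QState →ₗ[ℂ] QState :=
  QState.lift fun s =>
    Finsupp.single (s.erase i) ((Real.sqrt 2 : ℂ)⁻¹) +
      Finsupp.single (insert i s) ((if i ∈ s then -1 else 1) * (Real.sqrt 2 : ℂ)⁻¹)

/-- `π/8` gate `diag(1, exp(iπ/4))` on qubit `i`. -/
noncomputable def QState.gateT (i : ℕ) : QState →ₗ[ℂ] QState :=
  QState.lift fun s =>
    Finsupp.single s (if i ∈ s then Complex.exp (Complex.I * (Real.pi / 4)) else 1)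

/-- Controlled-not with control `i` and target `j` (the identity if `i = j`). -/
noncomputable def QState.gateCNOT (i j : ℕ) : QState →ₗ[ℂ] QState :=
  QState.lift fun s => Finsupp.single (if i ∈ s ∧ i ≠ j then symmDiff s {j} else s) 1

/-- Projection onto the subspace where qubit `i` has value `b`. -/
noncomputable def QState.proj (i : ℕ) (b : Bool) (ψ : QState) : QState :=
  ψ.filter fun s => decide (i ∈ s) = b

/-! # Quantum algorithms with a step count

A program acts on finitely many stacks of bits (the classical memory, equivalent to the tapes of a
Turing machine) and on a row of qubits, with the universal gate set X, H, T, CNOT and measurement.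
A qubit is addressed by the length of a stack.  Coins are obtained by measuring `H|0⟩`.
Loops are bounded by the length of a stack at loop entry; a machine that halts within a polynomial
number of steps is simulated, with polynomial overhead, by first writing its clock in unary on a stack
and then looping over that stack, so programs with polynomially bounded step count are exactly the
(quantum) polynomial-time algorithms. -/

inductive Prog : Type
  | skip : Prog
  /-- push a bit on stack `r` -/
  | push (r : ℕ) (b : Bool) : Prog
  /-- remove the top of stack `r` -/
  | pop (r : ℕ) : Prog
  | seq (p q : Prog) : Prog
  /-- branch according to whether stack `r` is empty, has top bit `0`, or has top bit `1` -/
  | cases (r : ℕ) (ifEmpty ifZero ifOne : Prog) : Prog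
  /-- run the body as many times as stack `r` has entries when the loop is entered -/
  | loop (r : ℕ) (body : Prog) : Prog
  | gateX (r : ℕ) : Prog
  | gateH (r : ℕ) : Prog
  | gateT (r : ℕ) : Prog
  | gateCNOT (r s : ℕ) : Prog
  /-- measure, in the computational basis, the qubit addressed by stack `r`; push the outcome on
  stack `s` -/
  | measure (r s : ℕ) : Prog
  /-- replace stack `s` by the answer of the oracle to the content of stack `r` -/
  | oracle (r s : ℕ) : Prog

/-- The program never calls the oracle. -/
def Prog.OracleFree : Prog → Prop
  | .seq p q => p.OracleFree ∧ q.OracleFree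
  | .cases _ p q r => p.OracleFree ∧ q.OracleFree ∧ r.OracleFree
  | .loop _ p => p.OracleFree
  | .oracle _ _ => False
  | _ => True

/-- A configuration of one branch of the computation: stacks, unnormalised state of the qubits (its
squared norm is the probability of the branch), and number of steps made so far. -/
structure Config where
  reg : ℕ → List Bool
  psi : QState
  time : ℕ

/-- Charge `t` steps. -/
def Config.tick (c : Config) (t : ℕ) : Config := { c with time := c.time + t }

/-- Overwrite stack `r`. -/
def Config.set (c : Config) (r : ℕ) (l : List Bool) : Config :=
  { c with reg := Function.update c.reg r l }

/-- Apply a linear map to the qubits. -/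
noncomputable def Config.apply (c : Config) (U : QState →ₗ[ℂ] QState) : Config :=
  { c with psi := U c.psi }

/-- All branches in which a computation with oracle `O` can end.  Each instruction costs one step; an
oracle call costs in addition the lengths of question and answer. -/
noncomputable def Prog.run (O : List Bool → List Bool) : Prog → Config → List Config
  | .skip, c => [c.tick 1]
  | .push r b, c => [(c.set r (b :: c.reg r)).tick 1]
  | .pop r, c => [(c.set r (c.reg r).tail).tick 1]
  | .seq p q, c => (p.run O c).flatMap fun c' => q.run O c'
  | .cases r p₀ p₁ p₂, c =>
      match c.reg r with
      | [] => p₀.run O (c.tick 1)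
      | false :: _ => p₁.run O (c.tick 1)
      | true :: _ => p₂.run O (c.tick 1)
  | .loop r p, c =>
      (fun L : List Config => L.flatMap fun c' => p.run O c')^[(c.reg r).length] [c.tick 1]
  | .gateX r, c => [(c.apply (QState.gateX (c.reg r).length)).tick 1]
  | .gateH r, c => [(c.apply (QState.gateH (c.reg r).length)).tick 1]
  | .gateT r, c => [(c.apply (QState.gateT (c.reg r).length)).tick 1]
  | .gateCNOT r s, c =>
      [(c.apply (QState.gateCNOT (c.reg r).length (c.reg s).length)).tick 1]
  | .measure r s, c =>
      [false, true].map fun b =>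
        Config.tick
          { c.set s (b :: c.reg s) with psi := QState.proj (c.reg r).length b c.psi } 1
  | .oracle r s, c =>
      [(c.set s (O (c.reg r))).tick (1 + (c.reg r).length + (O (c.reg r)).length)]

/-- Initial configuration: stack `0` (the output stack) is empty, the inputs are on stacks `1, 2, …`
(first bit on top), and the qubits are in state `ψ`. -/
noncomputable def Config.init (inputs : List (List Bool)) (ψ : QState) : Config where
  reg r := if r = 0 then [] else inputs.getD (r - 1) []
  psi := ψ
  time := 0

/-- Every branch of nonzero probability ends within `B` steps. -/
def HaltsWithin (cs : List Config) (B : ℕ) : Prop :=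
  ∀ c ∈ cs, c.psi ≠ 0 → c.time ≤ B

/-- Probability distribution of the content of the output stack. -/
noncomputable def outDist (cs : List Config) : List Bool →₀ ℝ :=
  (cs.map fun c => Finsupp.single (c.reg 0) c.psi.normSq).sum

/-! # Uncertainty about the seed -/

/-- Conditional Shannon entropy `H(X | W)` in bits, for `X` uniform on `α` and `W` distributed
according to `D x` given `X = x`:
`∑ Pr(X = x, W = w) * log₂ (Pr(W = w) / Pr(X = x, W = w))`. -/
noncomputable def condEntropy {α β : Type*} [Fintype α] (D : α → β →₀ ℝ) : ℝ :=
  (Fintype.card α : ℝ)⁻¹ *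
    ∑ x, (D x).sum fun w pr => pr * Real.logb 2 ((∑ x', D x' w) / pr)

/-- Probability that `W` is the seed `X` itself, for a uniform seed `X` of `n` bits and `W`
distributed according to `D x` given `X = x`. -/
noncomputable def guessProb {n : ℕ} (D : (Fin n → Bool) → List Bool →₀ ℝ) : ℝ :=
  (Fintype.card (Fin n → Bool) : ℝ)⁻¹ * ∑ x, D x (List.ofFn x)

/-! # Generators and attacks on them -/

/-- `G n x i` is bit number `i` (counted from `0`) generated from the seed `x` of `n` bits. -/
abbrev Generator : Type := (n : ℕ) → (Fin n → Bool) → ℕ → Bool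

/-- Unary notation. -/
def unary (n : ℕ) : List Bool := List.replicate n true

/-- Input of an attack on `G`: `n` in unary, the generated bits with index in `I`, in increasing order
of the index, and `I` itself as a bit mask of length `w`. -/
def attackInput (G : Generator) (n w : ℕ) (I : Finset ℕ) (x : Fin n → Bool) : List (List Bool) :=
  [unary n,
   ((List.range w).filter fun i => decide (i ∈ I)).map (G n x),
   (List.range w).map fun i => decide (i ∈ I)]

/-- Branches of the attack `P` on `G`. -/
noncomputable def attackRun (G : Generator) (P : Prog) (n w : ℕ) (I : Finset ℕ)
    (x : Fin n → Bool) : List Config :=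
  P.run (fun _ => []) (Config.init (attackInput G n w I x) QState.zero)

/-- `G` is attackable in quantum polynomial time from `p n` generated bits: from any `p n`, not
necessarily contiguous, of the first `8 * p n` generated bits, `P` produces a `W` with
`H(X | W) = O(2⁻ⁿ)`. -/
def Attackable (G : Generator) (p : Polynomial ℕ) : Prop :=
  ∃ (P : Prog) (q : Polynomial ℕ) (C : ℝ), P.OracleFree ∧
    ∀ (n : ℕ) (I : Finset ℕ), I ⊆ Finset.range (8 * p.eval n) → I.card = p.eval n →
      (∀ x, HaltsWithin (attackRun G P n (8 * p.eval n) I x) (q.eval n)) ∧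
      condEntropy (fun x => outDist (attackRun G P n (8 * p.eval n) I x)) ≤ C * (1 / 2) ^ n

/-- The operational form: `P` computes the seed, except with probability `O(2⁻ⁿ)`. -/
def SeedComputable (G : Generator) (p : Polynomial ℕ) : Prop :=
  ∃ (P : Prog) (q : Polynomial ℕ) (C : ℝ), P.OracleFree ∧
    ∀ (n : ℕ) (I : Finset ℕ), I ⊆ Finset.range (8 * p.eval n) → I.card = p.eval n →
      (∀ x, HaltsWithin (attackRun G P n (8 * p.eval n) I x) (q.eval n)) ∧
      1 - C * (1 / 2) ^ n ≤
        guessProb (fun x => outDist (attackRun G P n (8 * p.eval n) I x))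

/-! # The authentication scheme -/

/-- Messages are strings of `msgLen n` bits, tags are elements of a set with `tagCard n` elements, and
`hashes n` is the class of hash functions from which the (first) key selects one. -/
structure HashScheme where
  msgLen : ℕ → ℕ
  tagCard : ℕ → ℕ
  two_le_tagCard : ∀ n, 2 ≤ tagCard n
  hashes : ∀ n, Set ((Fin (msgLen n) → Bool) → Fin (tagCard n))

/-- Messages. -/
abbrev HashScheme.Msg (S : HashScheme) (n : ℕ) : Type := Fin (S.msgLen n) → Bool

/-- Number `k = ⌈log₂ |𝒯|⌉` of bits of a tag. -/
def HashScheme.tagLen (S : HashScheme) (n : ℕ) : ℕ := Nat.clog 2 (S.tagCard n)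

/-- Access to the hash function `h`: a message is answered with the bits of its tag. -/
def HashScheme.hashOracle (S : HashScheme) (n : ℕ) (h : S.Msg n → Fin (S.tagCard n)) :
    List Bool → List Bool :=
  fun y => (List.range (S.tagLen n)).map
    (Nat.testBit (h fun i : Fin (S.msgLen n) => y.getD i false))

/-- The concatenation of the tags of the messages `Y 0, Y 1, …`, as a stream of bits. -/
def HashScheme.tagStream (S : HashScheme) (n : ℕ) (h : S.Msg n → Fin (S.tagCard n))
    (Y : ℕ → S.Msg n) (i : ℕ) : Bool :=
  Nat.testBit (h (Y (i / S.tagLen n))) (i % S.tagLen n)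

/-- Amplitude at `|z⟩` of the encoding of bit `t` in basis `b`: `|0⟩, |1⟩` for `b = 0` and
`|+⟩, |-⟩` for `b = 1`. -/
noncomputable def codeAmp (b t z : Bool) : ℂ :=
  if b then (if t && z then -1 else 1) * (Real.sqrt 2 : ℂ)⁻¹ else if t = z then 1 else 0

/-- The product state of `L` qubits in which qubit `i` encodes the bit `t i` in basis `b i`. -/
noncomputable def codeState (L : ℕ) (b t : ℕ → Bool) : QState :=
  ∑ s ∈ (Finset.range L).powerset,
    Finsupp.single s (∏ i ∈ Finset.range L, codeAmp (b i) (t i) (decide (i ∈ s)))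

/-- Branches of an adversary `E` with access to `h`, who sees the first `N` messages and holds the
qubits that encode their tags in the bases selected by the bits generated from the seed `x`. -/
noncomputable def eveRun (G : Generator) (S : HashScheme) (E : Prog) (n N : ℕ)
    (h : S.Msg n → Fin (S.tagCard n)) (Y : ℕ → S.Msg n) (x : Fin n → Bool) : List Config :=
  E.run (S.hashOracle n h)
    (Config.init
      [unary n, unary (S.msgLen n), unary (S.tagLen n), unary N,
        ((List.range N).map fun j => List.ofFn (Y j)).flatten]
      (codeState (N * S.tagLen n) (G n x) (S.tagStream n h Y)))

/-- A quantum adversary, in time polynomial in the size of her data, makes the uncertainty about the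
seed exponentially small as soon as the observed tags comprise at least `m n` bits. -/
def SeedLeaks (G : Generator) (S : HashScheme) (m : ℕ → ℕ) : Prop :=
  ∃ (E : Prog) (q : Polynomial ℕ) (C c : ℝ), 0 < c ∧
    ∀ n N : ℕ, m n ≤ N * S.tagLen n → ∀ h ∈ S.hashes n, ∀ Y : ℕ → S.Msg n,
      (∀ x, HaltsWithin (eveRun G S E n N h Y x)
        (q.eval (n + N + S.msgLen n + S.tagLen n))) ∧
      condEntropy (fun x => outDist (eveRun G S E n N h Y x)) ≤ C * (2 : ℝ) ^ (-(c * n))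

/-- A quantum adversary, in time polynomial in the size of her data, computes the seed except with
exponentially small probability as soon as the observed tags comprise at least `m n` bits. -/
def SeedRecovered (G : Generator) (S : HashScheme) (m : ℕ → ℕ) : Prop :=
  ∃ (E : Prog) (q : Polynomial ℕ) (C c : ℝ), 0 < c ∧
    ∀ n N : ℕ, m n ≤ N * S.tagLen n → ∀ h ∈ S.hashes n, ∀ Y : ℕ → S.Msg n,
      (∀ x, HaltsWithin (eveRun G S E n N h Y x)
        (q.eval (n + N + S.msgLen n + S.tagLen n))) ∧
      1 - C * (2 : ℝ) ^ (-(c * n)) ≤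
        guessProb (fun x => outDist (eveRun G S E n N h Y x))

/-! # Gates on the qubits -/

namespace QState

/-! The adversary asks the oracle for all tag bits and measures each of the first `8 * p n` qubits
in a random basis. A measurement in the encoding basis always returns the tag bit, so an outcome
that differs from the tag bit proves that the other basis was used and reveals the generated bit.
This happens with probability 1/2 · 1/2 = 1/4, independently for each index and independently of the
seed (`norm_measureAmp_sq`, `Prog.samples_pickOne`). About twice as many indices as needed are
conclusive; a Chernoff bound gives fewer than `p n` with probability at most `0.69 ^ p n`
(`pickDist_fail_le`). Otherwise the adversary runs the given attack on `p n` conclusive bits.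

The set `J` of indices used has a law that does not depend on the seed. If `J` is part of the
output, the conditional entropy is therefore the average over `J` of the entropies left by the
attack, with the prior entropy `n` when too few bits were found (`condEntropy_mixture`,
`condEntropy_pick_le`). The guessing probability is affine in the output law and is averaged
directly (`le_guessProb_pick`).

The error `0.69 ^ p n` has to be small in `n`, although `p n < n` is allowed. But fewer than `n`
bits cannot determine `n` seed bits: counting inputs of the attack forces `2 ^ n ≤ 2 * C` for such
`n` (`two_pow_le_of_condEntropy_le`, `two_pow_le_of_le_guessProb`), and the constant absorbs these
cases (`fail_pow_le`).

The rest shows that an explicit program does this in polynomial time. Measuring a qubit of a product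
state and resetting it leaves a multiple of the same product state in each branch, so the branches
form a classical random process (`Samples`). Runs commute with scaling the state, shifting the clock
and changing stacks that the program does not use (`Prog.run_modify`); this gives composition of
such processes and lets the mask of `J` survive the attack on a stack beyond its reach. -/

theorem normSq_eq_sum (ψ : QState) {T : Finset (Finset ℕ)} (hT : ψ.support ⊆ T) :
    ψ.normSq = ∑ s ∈ T, ‖ψ s‖ ^ 2 :=
  Finsupp.sum_of_support_subset _ hT _ (by simp)

theorem normSq_nonneg (ψ : QState) : 0 ≤ ψ.normSq :=
  Finset.sum_nonneg fun _ _ => by positivity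

theorem normSq_smul (a : ℂ) (ψ : QState) : (a • ψ).normSq = ‖a‖ ^ 2 * ψ.normSq := by
  rw [normSq_eq_sum (a • ψ) Finsupp.support_smul, normSq_eq_sum ψ subset_rfl, Finset.mul_sum]
  exact Finset.sum_congr rfl fun s _ => by simp [mul_pow]

@[simp] theorem normSq_zero : normSq 0 = 0 := by simp [normSq]

@[simp] theorem normSq_zero_state : normSq QState.zero = 1 := by simp [normSq, QState.zero]

/-- Stated for pairs because the Hadamard gate and measurement do not preserve single amplitudes in
absolute value; only a sum over two states can be compared pointwise. -/
theorem normSq_add_congr {ψ φ ψ' φ' : QState}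
    (h : ∀ s, ‖ψ s‖ ^ 2 + ‖φ s‖ ^ 2 = ‖ψ' s‖ ^ 2 + ‖φ' s‖ ^ 2) :
    ψ.normSq + φ.normSq = ψ'.normSq + φ'.normSq := by
  classical
  set T := ψ.support ∪ φ.support ∪ ψ'.support ∪ φ'.support
  rw [normSq_eq_sum ψ (T := T) (by intro s; simp +contextual [T]),
    normSq_eq_sum φ (T := T) (by intro s; simp +contextual [T]),
    normSq_eq_sum ψ' (T := T) (by intro s; simp +contextual [T]),
    normSq_eq_sum φ' (T := T) (by intro s; simp +contextual [T]),
    ← Finset.sum_add_distrib, ← Finset.sum_add_distrib]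
  exact Finset.sum_congr rfl fun s _ => h s

theorem normSq_congr {ψ φ : QState} (h : ∀ s, ‖φ s‖ = ‖ψ s‖) : φ.normSq = ψ.normSq := by
  simpa using normSq_add_congr (ψ := φ) (φ := 0) (ψ' := ψ) (φ' := 0) (by simp [h])

theorem normSq_of_involutive {ψ φ : QState} {e : Finset ℕ → Finset ℕ}
    (he : Function.Involutive e) (h : ∀ s, φ s = ψ (e s)) : φ.normSq = ψ.normSq := by
  rw [normSq_eq_sum φ subset_rfl, normSq_eq_sum ψ subset_rfl]
  refine Finset.sum_bij' (fun s _ => e s) (fun s _ => e s) ?_ ?_ ?_ ?_ ?_ <;>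
    simp +contextual [h, he _]

theorem symmDiff_singleton_involutive (i : ℕ) :
    Function.Involutive fun s : Finset ℕ => symmDiff s {i} := fun s => by
  simp [symmDiff_symmDiff_cancel_right]

theorem lift_apply (f : Finset ℕ → QState) (ψ : QState) (s : Finset ℕ) :
    QState.lift f ψ s = ψ.sum fun r z => z * f r s := by
  simp [QState.lift, Finsupp.linearCombination_apply, Finsupp.sum, Finsupp.finsetSum_apply]

theorem gateX_apply (i : ℕ) (ψ : QState) (s : Finset ℕ) :
    gateX i ψ s = ψ (symmDiff s {i}) := by
  rw [gateX, lift_apply, Finsupp.sum_eq_single (symmDiff s {i})]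
  · simp [symmDiff_symmDiff_cancel_right]
  · intro r _ hr
    rw [Finsupp.single_apply, if_neg, mul_zero]
    rintro rfl
    exact hr (by simp [symmDiff_symmDiff_cancel_right])
  · simp

theorem gateT_apply (i : ℕ) (ψ : QState) (s : Finset ℕ) :
    gateT i ψ s =
      ψ s * (if i ∈ s then Complex.exp (Complex.I * (Real.pi / 4)) else 1) := by
  rw [gateT, lift_apply, Finsupp.sum_eq_single s]
  · simp
  · intro r _ hr
    rw [Finsupp.single_apply, if_neg hr, mul_zero]
  · simp

theorem cnot_involutive (i j : ℕ) : Function.Involutive fun s : Finset ℕ =>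
    if i ∈ s ∧ i ≠ j then symmDiff s {j} else s := by
  intro s
  by_cases h : i ∈ s ∧ i ≠ j
  · have : i ∈ symmDiff s {j} ∧ i ≠ j := ⟨by simp [Finset.mem_symmDiff, h.1, h.2], h.2⟩
    simp only [if_pos h, if_pos this, symmDiff_symmDiff_cancel_right]
  · simp only [if_neg h]

theorem gateCNOT_apply (i j : ℕ) (ψ : QState) (s : Finset ℕ) :
    gateCNOT i j ψ s = ψ (if i ∈ s ∧ i ≠ j then symmDiff s {j} else s) := by
  have he := cnot_involutive i j
  rw [gateCNOT, lift_apply,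
    Finsupp.sum_eq_single (if i ∈ s ∧ i ≠ j then symmDiff s {j} else s)]
  · have := he s
    simp only at this
    rw [this]
    simp
  · intro r _ hr
    rw [Finsupp.single_apply, if_neg, mul_zero]
    intro h
    refine hr ?_
    rw [← h]
    exact (he r).symm
  · simp

/-- Two basis vectors, `s` and its flip, contribute to the amplitude at `s`, so in contrast to the
permutation and diagonal gates no single term survives; linearity reduces to basis vectors. -/
theorem gateH_apply (i : ℕ) (ψ : QState) (s : Finset ℕ) :
    gateH i ψ s = (Real.sqrt 2 : ℂ)⁻¹ *
      (if i ∈ s then ψ (symmDiff s {i}) - ψ s else ψ s + ψ (symmDiff s {i})) := by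
  induction ψ using Finsupp.induction_linear with
  | zero => simp
  | add f g hf hg => rw [map_add, Finsupp.add_apply, hf, hg]; split_ifs <;> simp <;> ring
  | single r z =>
    have key : (r = symmDiff s {i}) ↔ (symmDiff r {i} = s) := by
      constructor <;> rintro rfl <;> simp [symmDiff_symmDiff_cancel_right]
    have hne : symmDiff r {i} ≠ r := by
      intro h
      have := congrArg (fun t => i ∈ t) h
      by_cases hi : i ∈ r <;> simp [Finset.mem_symmDiff, hi] at this
    simp only [gateH, QState.lift, Finsupp.linearCombination_single, Finsupp.smul_apply,
      Finsupp.add_apply, Finsupp.single_apply, smul_eq_mul, key]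
    by_cases hr : i ∈ r
    · have e1 : r.erase i = symmDiff r {i} := by
        ext j; by_cases hj : j = i <;> simp [Finset.mem_symmDiff, hj, hr]
      have e2 : insert i r = r := Finset.insert_eq_self.2 hr
      simp only [e1, e2, hr, if_true]
      by_cases h1 : r = s
      · subst h1; simp [hr, hne]; ring
      · by_cases h2 : symmDiff r {i} = s
        · have : i ∉ s := by rw [← h2]; simp [Finset.mem_symmDiff, hr]
          simp [h1, h2, this]; ring
        · simp [h1, h2]
    · have e1 : r.erase i = r := Finset.erase_eq_self.2 hr
      have e2 : insert i r = symmDiff r {i} := by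
        ext j; by_cases hj : j = i <;> simp [Finset.mem_symmDiff, hj, hr]
      simp only [e1, e2, hr, if_false]
      by_cases h1 : r = s
      · subst h1; simp [hr, hne]; ring
      · by_cases h2 : symmDiff r {i} = s
        · have : i ∈ s := by rw [← h2]; simp [Finset.mem_symmDiff, hr]
          simp [h1, h2, this]; ring
        · simp [h1, h2]

theorem proj_apply (i : ℕ) (b : Bool) (ψ : QState) (s : Finset ℕ) :
    proj i b ψ s = if decide (i ∈ s) = b then ψ s else 0 := by
  simp [proj, Finsupp.filter_apply]

theorem normSq_gateX (i : ℕ) (ψ : QState) : (gateX i ψ).normSq = ψ.normSq :=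
  normSq_of_involutive (symmDiff_singleton_involutive i) (gateX_apply i ψ)

theorem normSq_gateCNOT (i j : ℕ) (ψ : QState) : (gateCNOT i j ψ).normSq = ψ.normSq :=
  normSq_of_involutive (cnot_involutive i j) (gateCNOT_apply i j ψ)

theorem normSq_gateT (i : ℕ) (ψ : QState) : (gateT i ψ).normSq = ψ.normSq := by
  refine normSq_congr fun s => ?_
  rw [gateT_apply, norm_mul]
  split_ifs
  · have : Complex.I * (Real.pi / 4 : ℂ) = ((Real.pi / 4 : ℝ) : ℂ) * Complex.I := by
      push_cast; ring
    rw [this, Complex.norm_exp_ofReal_mul_I, mul_one]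
  · simp

theorem norm_inv_sqrt_two_sq : ‖(Real.sqrt 2 : ℂ)⁻¹‖ ^ 2 = 1 / 2 := by
  rw [norm_inv, Complex.norm_real, inv_pow, Real.norm_eq_abs, sq_abs, Real.sq_sqrt] <;> norm_num

theorem normSq_gateH (i : ℕ) (ψ : QState) : (gateH i ψ).normSq = ψ.normSq := by
  -- Adding the flipped state puts the amplitudes at `s` and at its flip into the same term, where
  -- the parallelogram law applies. Each norm is then counted twice.
  have h := normSq_add_congr (ψ := gateH i ψ) (φ := gateX i (gateH i ψ)) (ψ' := ψ)
    (φ' := gateX i ψ) fun s => by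
      have hp := fun a b : ℂ => parallelogram_law_with_norm ℝ a b
      have hm : i ∈ symmDiff s {i} ↔ i ∉ s := by
        by_cases hi : i ∈ s <;> simp [Finset.mem_symmDiff, hi]
      rw [gateX_apply, gateX_apply, gateH_apply, gateH_apply, norm_mul, norm_mul, mul_pow,
        mul_pow, norm_inv_sqrt_two_sq]
      simp only [hm, symmDiff_symmDiff_cancel_right]
      by_cases hi : i ∈ s
      · simp only [hi, not_true, if_true, if_false]
        have := hp (ψ (symmDiff s {i})) (ψ s)
        nlinarith
      · simp only [hi, not_false_eq_true, if_true, if_false]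
        have := hp (ψ s) (ψ (symmDiff s {i}))
        nlinarith
  rw [normSq_gateX, normSq_gateX] at h
  linarith

theorem normSq_proj (i : ℕ) (ψ : QState) :
    (proj i false ψ).normSq + (proj i true ψ).normSq = ψ.normSq := by
  simpa using normSq_add_congr (ψ := proj i false ψ) (φ := proj i true ψ) (ψ' := ψ) (φ' := 0)
    fun s => by by_cases hi : i ∈ s <;> simp [proj_apply, hi]

@[simp] theorem proj_add (i : ℕ) (b : Bool) (ψ φ : QState) :
    proj i b (ψ + φ) = proj i b ψ + proj i b φ := Finsupp.filter_add

@[simp] theorem proj_smul (i : ℕ) (b : Bool) (a : ℂ) (ψ : QState) :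
    proj i b (a • ψ) = a • proj i b ψ := Finsupp.filter_smul

/-- Qubit `i` is in state `|0⟩`. -/
def Clear (i : ℕ) (ψ : QState) : Prop := ∀ s, i ∈ s → ψ s = 0

section Clear

variable {i : ℕ} {ψ : QState}

theorem Clear.proj_false (h : Clear i ψ) : proj i false ψ = ψ := by
  ext s; by_cases hi : i ∈ s <;> simp [proj_apply, hi, h s]

theorem Clear.proj_true (h : Clear i ψ) : proj i true ψ = 0 := by
  ext s; by_cases hi : i ∈ s <;> simp [proj_apply, hi, h s]

theorem Clear.proj_false_gateX (h : Clear i ψ) : proj i false (gateX i ψ) = 0 := by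
  ext s
  by_cases hi : i ∈ s
  · simp [proj_apply, hi]
  · simp [proj_apply, hi, gateX_apply, h (symmDiff s {i}) (by simp [Finset.mem_symmDiff, hi])]

theorem Clear.proj_true_gateX (h : Clear i ψ) : proj i true (gateX i ψ) = gateX i ψ := by
  ext s
  by_cases hi : i ∈ s
  · simp [proj_apply, hi]
  · simp [proj_apply, hi, gateX_apply, h (symmDiff s {i}) (by simp [Finset.mem_symmDiff, hi])]

theorem gateX_gateX (i : ℕ) (ψ : QState) : gateX i (gateX i ψ) = ψ := by
  ext s; simp [gateX_apply, symmDiff_symmDiff_cancel_right]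

/-- With `Clear.gateH_gateX` this describes the Hadamard gate on a qubit that is not entangled with
the rest. It serves both for tossing a coin and for changing the measurement basis. -/
theorem Clear.gateH (h : Clear i ψ) :
    QState.gateH i ψ = (Real.sqrt 2 : ℂ)⁻¹ • (ψ + gateX i ψ) := by
  ext s
  rw [gateH_apply, Finsupp.smul_apply, Finsupp.add_apply, gateX_apply, smul_eq_mul]
  by_cases hi : i ∈ s
  · simp [hi, h s hi]
  · simp [hi]

theorem Clear.gateH_gateX (h : Clear i ψ) :
    QState.gateH i (gateX i ψ) = (Real.sqrt 2 : ℂ)⁻¹ • (ψ - gateX i ψ) := by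
  ext s
  rw [gateH_apply, Finsupp.smul_apply, Finsupp.sub_apply, gateX_apply, gateX_apply, smul_eq_mul,
    symmDiff_symmDiff_cancel_right]
  by_cases hi : i ∈ s
  · simp [hi]
  · simp [hi, h (symmDiff s {i}) (by simp [Finset.mem_symmDiff, hi])]

end Clear

end QState

/-- The subsets of `range (L + 1)` are split according to whether they contain `L`. The result, two
multiples of a state with qubit `L` clear and of its flip, is the form in which
`Prog.samples_measureReset` takes its input. -/
theorem codeState_succ (L : ℕ) (b t : ℕ → Bool) :
    codeState (L + 1) b t = codeAmp (b L) (t L) false • codeState L b t +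
      codeAmp (b L) (t L) true • QState.gateX L (codeState L b t) := by
  have hmem : ∀ s ∈ (Finset.range L).powerset, L ∉ s := fun s hs hL => by
    simpa using Finset.mem_powerset.1 hs hL
  rw [codeState, Finset.range_add_one, Finset.sum_powerset_insert (by simp), codeState, map_sum,
    Finset.smul_sum, Finset.smul_sum]
  congr 1
  · refine Finset.sum_congr rfl fun s hs => ?_
    rw [Finset.prod_insert (by simp), Finsupp.smul_single]
    simp [hmem s hs]
  · refine Finset.sum_congr rfl fun s hs => ?_
    have e : symmDiff s {L} = insert L s := by
      ext j; by_cases hj : j = L <;> simp [Finset.mem_symmDiff, hj, hmem s hs]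
    rw [Finset.prod_insert (by simp), QState.gateX, QState.lift,
      Finsupp.linearCombination_single, Finsupp.smul_single, Finsupp.smul_single, e]
    congr 1
    simp only [Finset.mem_insert, true_or, decide_true, smul_eq_mul, mul_one]
    congr 1
    refine Finset.prod_congr rfl fun i hi => ?_
    have : i ≠ L := by have := Finset.mem_range.1 hi; omega
    simp [this]

theorem codeState_clear (L : ℕ) (b t : ℕ → Bool) {i : ℕ} (hi : L ≤ i) :
    QState.Clear i (codeState L b t) := by
  intro s hs
  rw [codeState, Finsupp.finsetSum_apply]
  refine Finset.sum_eq_zero fun r hr => ?_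
  rw [Finsupp.single_apply, if_neg]
  rintro rfl
  have := Finset.mem_range.1 (Finset.mem_powerset.1 hr hs)
  omega

@[simp] theorem codeState_zero (b t : ℕ → Bool) : codeState 0 b t = QState.zero := by
  simp [codeState, QState.zero]

/-! # Runs of programs -/

/-- A number larger than that of every stack that occurs in the program. -/
def Prog.regBound : Prog → ℕ
  | .skip => 0
  | .push r _ => r + 1
  | .pop r => r + 1
  | .seq p q => max p.regBound q.regBound
  | .cases r p q s => max (r + 1) (max p.regBound (max q.regBound s.regBound))
  | .loop r p => max (r + 1) p.regBound
  | .gateX r => r + 1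
  | .gateH r => r + 1
  | .gateT r => r + 1
  | .gateCNOT r s => max (r + 1) (s + 1)
  | .measure r s => max (r + 1) (s + 1)
  | .oracle r s => max (r + 1) (s + 1)

/-- Replace stack `r` by `o r` where this is defined, scale the state of the qubits by `a`, and shift
the clock by `t`. -/
noncomputable def Config.modify (o : ℕ → Option (List Bool)) (a : ℂ) (t : ℕ) (c : Config) : Config where
  reg r := (o r).getD (c.reg r)
  psi := a • c.psi
  time := c.time + t

section Modify

variable (o : ℕ → Option (List Bool)) (a : ℂ) (t : ℕ)

theorem Config.modify_tick (c : Config) (u : ℕ) :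
    (c.tick u).modify o a t = (c.modify o a t).tick u := by
  simp [Config.modify, Config.tick, Nat.add_right_comm]

theorem Config.modify_set (c : Config) {r : ℕ} (hr : o r = none) (l : List Bool) :
    (c.set r l).modify o a t = (c.modify o a t).set r l := by
  simp only [Config.modify, Config.set, Config.mk.injEq, and_true]
  funext r'
  by_cases h : r' = r
  · subst h; simp [hr]
  · simp [Function.update_of_ne h]

theorem Config.modify_reg (c : Config) {r : ℕ} (hr : o r = none) :
    (c.modify o a t).reg r = c.reg r := by
  simp [Config.modify, hr]

theorem Config.modify_apply (c : Config) (U : QState →ₗ[ℂ] QState) :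
    (c.apply U).modify o a t = (c.modify o a t).apply U := by
  simp [Config.modify, Config.apply]

theorem List.iterate_flatMap_map {α : Type*} {f : α → List α} {T : α → α}
    (h : ∀ c, f (T c) = (f c).map T) (k : ℕ) (L : List α) :
    (fun L : List α => L.flatMap f)^[k] (L.map T) =
      ((fun L : List α => L.flatMap f)^[k] L).map T := by
  induction k generalizing L with
  | zero => rfl
  | succ k ih =>
    simp only [Function.iterate_succ, Function.comp_apply]
    rw [← ih, List.flatMap_map, List.map_flatMap]
    simp only [h]

/-- Every instruction is linear in the qubits, adds to the clock an amount that does not depend on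
it, and reads and writes only stacks below `regBound`. With `o` undefined everywhere this is
scaling; with `o` defined at one large stack it lets data pass untouched through an arbitrary
program. -/
theorem Prog.run_modify (O : List Bool → List Bool) (P : Prog)
    (ho : ∀ r < P.regBound, o r = none) (c : Config) :
    P.run O (c.modify o a t) = (P.run O c).map (Config.modify o a t) := by
  induction P generalizing c with
  | skip => simp [Prog.run, Config.modify_tick]
  | push r b =>
    have hr := ho r (by simp [regBound])
    simp [Prog.run, Config.modify_tick, Config.modify_set _ _ _ _ hr, Config.modify_reg _ _ _ _ hr]
  | pop r =>
    have hr := ho r (by simp [regBound])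
    simp [Prog.run, Config.modify_tick, Config.modify_set _ _ _ _ hr, Config.modify_reg _ _ _ _ hr]
  | seq p q hp hq =>
    have h1 := hp fun r hr => ho r (by simp [regBound, hr])
    have h2 := hq fun r hr => ho r (by simp [regBound, hr])
    simp only [Prog.run, h1, List.flatMap_map, List.map_flatMap, h2]
  | cases r p q s hp hq hs =>
    have hr := ho r (by simp [regBound])
    have h1 := hp fun r hr => ho r (by simp [regBound, hr])
    have h2 := hq fun r hr => ho r (by simp [regBound, hr])
    have h3 := hs fun r hr => ho r (by simp [regBound, hr])
    simp only [Prog.run, Config.modify_reg _ _ _ _ hr, ← Config.modify_tick]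
    split <;> simp only [h1, h2, h3]
  | loop r p hp =>
    have hr := ho r (by simp [regBound])
    have h1 := hp fun r hr => ho r (by simp [regBound, hr])
    simp only [Prog.run, Config.modify_reg _ _ _ _ hr, ← Config.modify_tick]
    exact List.iterate_flatMap_map h1 _ [_]
  | gateX r =>
    have hr := ho r (by simp [regBound])
    simp [Prog.run, Config.modify_tick, Config.modify_apply, Config.modify_reg _ _ _ _ hr]
  | gateH r =>
    have hr := ho r (by simp [regBound])
    simp [Prog.run, Config.modify_tick, Config.modify_apply, Config.modify_reg _ _ _ _ hr]
  | gateT r =>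
    have hr := ho r (by simp [regBound])
    simp [Prog.run, Config.modify_tick, Config.modify_apply, Config.modify_reg _ _ _ _ hr]
  | gateCNOT r s =>
    have hr := ho r (by simp [regBound])
    have hs := ho s (by simp [regBound])
    simp [Prog.run, Config.modify_tick, Config.modify_apply, Config.modify_reg _ _ _ _ hr,
      Config.modify_reg _ _ _ _ hs]
  | measure r s =>
    have hr := ho r (by simp [regBound])
    have hs := ho s (by simp [regBound])
    have key : ∀ b, Config.modify o a t { c.set s (b :: c.reg s) with
        psi := QState.proj (c.reg r).length b c.psi } =
        { (c.modify o a t).set s (b :: c.reg s) with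
          psi := QState.proj (c.reg r).length b (c.modify o a t).psi } := fun b => by
      rw [← Config.modify_set _ _ _ _ hs]
      simp [Config.modify, Config.set]
    simp [Prog.run, Config.modify_tick, key, Config.modify_reg _ _ _ _ hr,
      Config.modify_reg _ _ _ _ hs]
  | oracle r s =>
    have hr := ho r (by simp [regBound])
    have hs := ho s (by simp [regBound])
    simp [Prog.run, Config.modify_tick, Config.modify_set _ _ _ _ hs, Config.modify_reg _ _ _ _ hr]

end Modify

/-- Scale the state by `a` and shift the clock by `t`. -/
noncomputable abbrev Config.scale (a : ℂ) (t : ℕ) (c : Config) : Config :=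
  c.modify (fun _ => none) a t

theorem Prog.run_scale (O : List Bool → List Bool) (P : Prog) (a : ℂ) (t : ℕ) (c : Config) :
    P.run O (c.scale a t) = (P.run O c).map (Config.scale a t) :=
  Prog.run_modify _ _ _ _ _ (fun _ _ => rfl) _

theorem Config.scale_eq (a : ℂ) (t : ℕ) (c : Config) :
    c.scale a t = ⟨c.reg, a • c.psi, c.time + t⟩ := rfl

theorem Prog.psi_eq_zero_of_mem_run {O : List Bool → List Bool} {P : Prog} {c c' : Config}
    (hc : c.psi = 0) (h : c' ∈ P.run O c) : c'.psi = 0 := by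
  -- A configuration with zero state is its own multiple by the scalar 0, so all its descendants are
  -- multiples by 0 too.
  have e : c = c.scale 0 0 := by
    rw [Config.scale_eq]; cases c; simp_all
  rw [e, Prog.run_scale] at h
  obtain ⟨d, -, rfl⟩ := List.mem_map.1 h
  simp [Config.modify]

theorem Prog.OracleFree.run_eq {P : Prog} (hP : P.OracleFree) (O O' : List Bool → List Bool)
    (c : Config) : P.run O c = P.run O' c := by
  induction P generalizing c with
  | seq p q hp hq => simp only [Prog.run, hp hP.1, hq hP.2]
  | cases r p q s hp hq hs =>
    simp only [Prog.run]
    split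
    · exact hp hP.1 _
    · exact hq hP.2.1 _
    · exact hs hP.2.2 _
  | loop r p hp => simp only [Prog.run, hp hP]
  | oracle r s => exact hP.elim
  | _ => rfl

/-! # Output distributions -/

theorem List.sum_map_flatMap {α β M : Type*} [AddCommMonoid M] (l : List α) (f : α → List β)
    (F : β → M) : ((l.flatMap f).map F).sum = (l.map fun a => ((f a).map F).sum).sum := by
  induction l with
  | nil => rfl
  | cons a l ih => simp [ih]

/-- Gates are isometries and the two projections of a measurement split the squared norm. Hence
output distributions have total mass 1, which the counting bounds need. -/
theorem Prog.sum_normSq_run (O : List Bool → List Bool) (P : Prog) (c : Config) :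
    ((P.run O c).map fun c' => c'.psi.normSq).sum = c.psi.normSq := by
  induction P generalizing c with
  | seq p q hp hq => simp only [Prog.run, List.sum_map_flatMap, hp, hq]
  | cases r p q s hp hq hs =>
    simp only [Prog.run]
    split <;> simp only [hp, hq, hs] <;> rfl
  | loop r p hp =>
    have key : ∀ (k : ℕ) (L : List Config),
        (((fun L : List Config => L.flatMap fun c' => p.run O c')^[k] L).map
          fun c' => c'.psi.normSq).sum = (L.map fun c' => c'.psi.normSq).sum := by
      intro k
      induction k with
      | zero => intro L; rfl
      | succ k ih =>
        intro L
        simp only [Function.iterate_succ, Function.comp_apply]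
        rw [ih, List.sum_map_flatMap]
        simp only [hp]
    simp [Prog.run, key, Config.tick]
  | gateX r => simp [Prog.run, Config.tick, Config.apply, QState.normSq_gateX]
  | gateH r => simp [Prog.run, Config.tick, Config.apply, QState.normSq_gateH]
  | gateT r => simp [Prog.run, Config.tick, Config.apply, QState.normSq_gateT]
  | gateCNOT r s => simp [Prog.run, Config.tick, Config.apply, QState.normSq_gateCNOT]
  | measure r s => simp [Prog.run, Config.tick, QState.normSq_proj]
  | _ => simp [Prog.run, Config.tick, Config.set]

theorem outDist_flatMap {α : Type*} (l : List α) (f : α → List Config) :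
    outDist (l.flatMap f) = (l.map fun a => outDist (f a)).sum :=
  List.sum_map_flatMap l f _

theorem outDist_map_modify (o : ℕ → Option (List Bool)) (ho : o 0 = none) (a : ℂ) (t : ℕ)
    (cs : List Config) :
    outDist (cs.map (Config.modify o a t)) = ‖a‖ ^ 2 • outDist cs := by
  induction cs with
  | nil => simp [outDist]
  | cons c cs ih =>
    simp only [outDist, List.map_cons, List.sum_cons, smul_add] at ih ⊢
    rw [ih, Config.modify_reg _ _ _ _ ho]
    simp [Config.modify, QState.normSq_smul]

theorem outDist_nonneg (cs : List Config) (w : List Bool) : 0 ≤ outDist cs w := by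
  induction cs with
  | nil => simp [outDist]
  | cons c cs ih =>
    simp only [outDist, List.map_cons, List.sum_cons, Finsupp.add_apply] at ih ⊢
    refine add_nonneg ?_ ih
    rw [Finsupp.single_apply]
    split_ifs
    · exact c.psi.normSq_nonneg
    · exact le_rfl

theorem sum_outDist (cs : List Config) :
    (outDist cs).sum (fun _ r => r) = (cs.map fun c => c.psi.normSq).sum := by
  induction cs with
  | nil => simp [outDist]
  | cons c cs ih =>
    simp only [outDist, List.map_cons, List.sum_cons] at ih ⊢
    rw [Finsupp.sum_add_index' (by simp) (by simp), ih]
    simp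

theorem sum_outDist_attackRun (G : Generator) (P : Prog) (n w : ℕ) (I : Finset ℕ)
    (x : Fin n → Bool) : (outDist (attackRun G P n w I x)).sum (fun _ r => r) = 1 := by
  rw [sum_outDist, attackRun, Prog.sum_normSq_run]
  simp [Config.init]

/-! # Entropy of mixtures -/

section Entropy

variable {α β γ ι κ : Type*} [Fintype α]

/-- The label `J` can be read off the output and its weight `μ J` is the same for all `x`, so `μ J`
cancels in the quotient inside the logarithm. -/
theorem condEntropy_mixture (S : Finset ι) {μ : ι → ℝ} {e : ι → β → γ}
    (he : ∀ J ∈ S, ∀ J' ∈ S, ∀ w w', e J w = e J' w' → J = J' ∧ w = w')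
    (D : ι → α → β →₀ ℝ) :
    condEntropy (fun x => ∑ J ∈ S, μ J • Finsupp.mapDomain (e J) (D J x)) =
      ∑ J ∈ S, μ J * condEntropy (D J) := by
  classical
  set W : Finset β := S.biUnion fun J => Finset.univ.biUnion fun x => (D J x).support
  have hW : ∀ J ∈ S, ∀ x, (D J x).support ⊆ W := fun J hJ x w hw =>
    Finset.mem_biUnion.2 ⟨J, hJ, Finset.mem_biUnion.2 ⟨x, Finset.mem_univ _, hw⟩⟩
  have hval : ∀ x, ∀ J ∈ S, ∀ w,
      (∑ J ∈ S, μ J • Finsupp.mapDomain (e J) (D J x)) (e J w) = μ J * D J x w := by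
    intro x J hJ w
    rw [Finsupp.finsetSum_apply, Finset.sum_eq_single_of_mem J hJ]
    · rw [Finsupp.smul_apply, smul_eq_mul,
        Finsupp.mapDomain_apply fun w w' h => (he J hJ J hJ w w' h).2]
    · intro J' hJ' hne
      rw [Finsupp.smul_apply, Finsupp.mapDomain_of_notMem_range, smul_zero]
      rintro ⟨w', hw'⟩
      exact hne (he J' hJ' J hJ w' w hw').1
  set T : Finset γ := (S ×ˢ W).image fun q => e q.1 q.2
  have hT : ∀ x, (∑ J ∈ S, μ J • Finsupp.mapDomain (e J) (D J x)).support ⊆ T := by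
    intro x v hv
    by_contra hvT
    refine (Finsupp.mem_support_iff.1 hv) ?_
    rw [Finsupp.finsetSum_apply]
    refine Finset.sum_eq_zero fun J hJ => ?_
    rw [Finsupp.smul_apply, smul_eq_mul]
    suffices v ∉ (Finsupp.mapDomain (e J) (D J x)).support by
      rw [Finsupp.notMem_support_iff.1 this, mul_zero]
    intro hv'
    obtain ⟨w, hw, rfl⟩ := Finset.mem_image.1 (Finsupp.mapDomain_support hv')
    exact hvT (Finset.mem_image.2 ⟨(J, w), Finset.mem_product.2 ⟨hJ, hW J hJ x hw⟩, rfl⟩)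
  simp only [condEntropy]
  have h1 : ∀ x, ((∑ J ∈ S, μ J • Finsupp.mapDomain (e J) (D J x)).sum fun w pr =>
      pr * Real.logb 2 ((∑ x', (∑ J ∈ S, μ J • Finsupp.mapDomain (e J) (D J x')) w) / pr)) =
      ∑ J ∈ S, μ J * (D J x).sum fun w pr => pr * Real.logb 2 ((∑ x', D J x' w) / pr) := by
    intro x
    rw [Finsupp.sum_of_support_subset _ (hT x) _ (by simp), Finset.sum_image, Finset.sum_product]
    · refine Finset.sum_congr rfl fun J hJ => ?_
      rw [Finsupp.sum_of_support_subset _ (hW J hJ x) _ (by simp), Finset.mul_sum]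
      refine Finset.sum_congr rfl fun w _ => ?_
      simp only [hval _ J hJ]
      rw [← Finset.mul_sum]
      by_cases h0 : μ J = 0
      · simp [h0]
      · rw [mul_div_mul_left _ _ h0, mul_assoc]
    · rintro ⟨J, w⟩ hJ ⟨J', w'⟩ hJ' h
      obtain ⟨rfl, rfl⟩ := he J (Finset.mem_product.1 hJ).1 J' (Finset.mem_product.1 hJ').1 _ _ h
      rfl
  simp only [h1]
  rw [Finset.sum_comm, Finset.mul_sum]
  refine Finset.sum_congr rfl fun J _ => ?_
  rw [← Finset.mul_sum]
  ring

theorem condEntropy_single [Nonempty α] (v : β) :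
    condEntropy (fun _ : α => Finsupp.single v (1 : ℝ)) = Real.logb 2 (Fintype.card α) := by
  simp [condEntropy]

/-- If another `x'` has the same output law as `x`, then at every output the quotient inside the
logarithm is at least 2. So `x` contributes at least one bit to the sum, and the other contributions
are nonnegative. -/
theorem card_le_card_mul_condEntropy [DecidableEq α] {D : α → β →₀ ℝ} (h0 : ∀ x w, 0 ≤ D x w)
    (h1 : ∀ x, (D x).sum (fun _ r => r) = 1) (B : Finset α)
    (hB : ∀ x ∈ B, ∃ x', x' ≠ x ∧ D x' = D x) :
    (B.card : ℝ) ≤ Fintype.card α * condEntropy D := by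
  classical
  rcases isEmpty_or_nonempty α with hα | hα
  · simp [Finset.eq_empty_of_isEmpty B]
  have hcard : (Fintype.card α : ℝ) ≠ 0 := by exact_mod_cast Fintype.card_ne_zero
  rw [condEntropy, mul_inv_cancel_left₀ hcard]
  have hle : ∀ x w, D x w ≤ ∑ x', D x' w := fun x w =>
    Finset.single_le_sum (f := fun x' => D x' w) (fun x' _ => h0 x' w) (Finset.mem_univ x)
  have hnn : ∀ x, 0 ≤ (D x).sum fun w pr => pr * Real.logb 2 ((∑ x', D x' w) / pr) := by
    intro x
    refine Finset.sum_nonneg fun w hw => mul_nonneg (h0 x w) ?_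
    have hpos : 0 < D x w := lt_of_le_of_ne (h0 x w) (Ne.symm (Finsupp.mem_support_iff.1 hw))
    exact Real.logb_nonneg (by norm_num) ((one_le_div hpos).2 (hle x w))
  calc (B.card : ℝ) = ∑ x ∈ B, 1 := by simp
    _ ≤ ∑ x ∈ B, (D x).sum fun w pr => pr * Real.logb 2 ((∑ x', D x' w) / pr) := by
        refine Finset.sum_le_sum fun x hx => ?_
        obtain ⟨y, hne, hy⟩ := hB x hx
        rw [← h1 x]
        refine Finset.sum_le_sum fun w hw => ?_
        have hpos : 0 < D x w :=
          lt_of_le_of_ne (h0 x w) (Ne.symm (Finsupp.mem_support_iff.1 hw))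
        refine le_mul_of_one_le_right hpos.le ?_
        rw [Real.le_logb_iff_rpow_le (by norm_num)
          (div_pos (hpos.trans_le (hle x w)) hpos), Real.rpow_one, le_div_iff₀ hpos]
        calc 2 * D x w = ∑ x' ∈ {y, x}, D x' w := by
              rw [Finset.sum_pair hne, hy]; ring
          _ ≤ _ := Finset.sum_le_sum_of_subset_of_nonneg (Finset.subset_univ _)
              fun x' _ _ => h0 x' w
    _ ≤ _ := Finset.sum_le_sum_of_subset_of_nonneg (Finset.subset_univ _) fun x _ _ => hnn x

/-- On the elements that share their law with no other one, `f` is injective, so there are at most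
`Fintype.card κ` of them; all others cost a bit each. -/
theorem card_le_card_mul_condEntropy_add [DecidableEq α] [Fintype κ] {D : α → β →₀ ℝ}
    (h0 : ∀ x w, 0 ≤ D x w) (h1 : ∀ x, (D x).sum (fun _ r => r) = 1) (f : α → κ)
    (hf : ∀ x x', f x = f x' → D x = D x') :
    (Fintype.card α : ℝ) ≤ Fintype.card α * condEntropy D + Fintype.card κ := by
  classical
  set B : Finset α := Finset.univ.filter fun x => ∃ x', x' ≠ x ∧ D x' = D x
  have hB := card_le_card_mul_condEntropy h0 h1 B fun x hx => (Finset.mem_filter.1 hx).2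
  have hc : Bᶜ.card ≤ Fintype.card κ := by
    refine Finset.card_le_card_of_injOn f (t := Finset.univ) (by simp) ?_
    intro x hx x' hx' hxx
    by_contra hne
    have : x ∉ B := by simpa using hx
    exact this (Finset.mem_filter.2 ⟨Finset.mem_univ _, x', Ne.symm hne, hf _ _ hxx.symm⟩)
  have hsum : Bᶜ.card + B.card = Fintype.card α := by
    rw [Finset.card_compl]; exact Nat.sub_add_cancel (Finset.card_le_univ B)
  have : (Bᶜ.card : ℝ) ≤ Fintype.card κ := by exact_mod_cast hc
  have hs : (Bᶜ.card : ℝ) + B.card = Fintype.card α := by exact_mod_cast hsum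
  linarith

/-- On a fibre of `f` there is a single law, and the events of hitting the distinct values `v x` are
disjoint, so each fibre contributes at most 1. -/
theorem sum_apply_injective_le_card [Fintype κ] {D : α → β →₀ ℝ} (h0 : ∀ x w, 0 ≤ D x w)
    (h1 : ∀ x, (D x).sum (fun _ r => r) = 1) (f : α → κ) (hf : ∀ x x', f x = f x' → D x = D x')
    {v : α → β} (hv : Function.Injective v) : ∑ x, D x (v x) ≤ Fintype.card κ := by
  classical
  rw [← Finset.sum_fiberwise_of_maps_to (s := Finset.univ) (t := Finset.univ) (g := f) (by simp)]
  have : (Fintype.card κ : ℝ) = ∑ _k : κ, (1 : ℝ) := by simp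
  rw [this]
  refine Finset.sum_le_sum fun k _ => ?_
  set A := Finset.univ.filter fun x => f x = k
  rcases A.eq_empty_or_nonempty with hA | ⟨a, ha⟩
  · simp [hA]
  have hD : ∀ x ∈ A, D x = D a := fun x hx =>
    hf _ _ ((Finset.mem_filter.1 hx).2.trans (Finset.mem_filter.1 ha).2.symm)
  rw [Finset.sum_congr rfl fun x hx => by rw [hD x hx], ← h1 a,
    Finsupp.sum_of_support_subset (D a) (Finset.subset_union_left (s₂ := A.image v)) _ (by simp),
    ← Finset.sum_image (f := fun w => D a w) hv.injOn]
  exact Finset.sum_le_sum_of_subset_of_nonneg Finset.subset_union_right fun w _ _ => h0 a w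

end Entropy

/-! # The attack needs as many bits as the seed has -/

theorem attackRun_congr (G : Generator) (P : Prog) (n w : ℕ) (I : Finset ℕ) {x x' : Fin n → Bool}
    (h : (fun i : I => G n x i) = fun i : I => G n x' i) :
    attackRun G P n w I x = attackRun G P n w I x' := by
  have : ((List.range w).filter fun i => decide (i ∈ I)).map (G n x) =
      ((List.range w).filter fun i => decide (i ∈ I)).map (G n x') := by
    refine List.map_congr_left fun i hi => ?_
    have hi' : i ∈ I := by simpa using (List.mem_filter.1 hi).2
    exact congrFun h ⟨i, hi'⟩
  rw [attackRun, attackRun, attackInput, attackInput, this]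

/-- The attack sees the seed only through `m` bits, that is through at most `2 ^ m ≤ 2 ^ n / 2`
inputs. At least half of the seeds share their input with another one, so the entropy is at least
1/2; one index set suffices for this. -/
theorem two_pow_le_of_condEntropy_le {G : Generator} {P : Prog} {n m : ℕ} {C : ℝ}
    (hm : m < n) (h : ∀ I ⊆ Finset.range (8 * m), I.card = m →
      condEntropy (fun x => outDist (attackRun G P n (8 * m) I x)) ≤ C * (1 / 2) ^ n) :
    (2 : ℝ) ^ n ≤ 2 * C := by
  have h1 := h (Finset.range m) (Finset.range_subset_range.2 (by omega)) (by simp)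
  have h2 := card_le_card_mul_condEntropy_add
    (D := fun x => outDist (attackRun G P n (8 * m) (Finset.range m) x))
    (fun x w => outDist_nonneg _ w) (fun x => sum_outDist_attackRun _ _ _ _ _ _)
    (fun x (i : Finset.range m) => G n x i)
    (fun x x' hx => by rw [attackRun_congr G P n _ _ hx])
  simp only [Fintype.card_fun, Fintype.card_bool, Fintype.card_fin, Fintype.card_coe,
    Finset.card_range, Nat.cast_pow, Nat.cast_ofNat] at h2
  have h3 : (2 : ℝ) ^ m * 2 ≤ 2 ^ n := by
    rw [← pow_succ]; exact pow_le_pow_right₀ (by norm_num) hm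
  have h4 : (2 : ℝ) ^ n * (C * (1 / 2) ^ n) = C := by
    rw [mul_left_comm, ← mul_pow]; norm_num
  have h5 := mul_le_mul_of_nonneg_left h1 (by positivity : (0 : ℝ) ≤ 2 ^ n)
  linarith

/-- Same counting: with at most `2 ^ m` different inputs, the success probability is at most `2 ^ m
/ 2 ^ n ≤ 1 / 2`. -/
theorem two_pow_le_of_le_guessProb {G : Generator} {P : Prog} {n m : ℕ} {C : ℝ}
    (hm : m < n) (h : ∀ I ⊆ Finset.range (8 * m), I.card = m →
      1 - C * (1 / 2) ^ n ≤ guessProb (fun x => outDist (attackRun G P n (8 * m) I x))) :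
    (2 : ℝ) ^ n ≤ 2 * C := by
  have h1 := h (Finset.range m) (Finset.range_subset_range.2 (by omega)) (by simp)
  have h2 := sum_apply_injective_le_card
    (D := fun x => outDist (attackRun G P n (8 * m) (Finset.range m) x))
    (fun x w => outDist_nonneg _ w) (fun x => sum_outDist_attackRun _ _ _ _ _ _)
    (fun x (i : Finset.range m) => G n x i)
    (fun x x' hx => by rw [attackRun_congr G P n _ _ hx]) List.ofFn_injective
  simp only [guessProb, Fintype.card_fun, Fintype.card_bool, Fintype.card_fin, Fintype.card_coe,
    Finset.card_range, Nat.cast_pow, Nat.cast_ofNat] at h1 h2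
  have h3 : (2 : ℝ) ^ m * 2 ≤ 2 ^ n := by
    rw [← pow_succ]; exact pow_le_pow_right₀ (by norm_num) hm
  have h4 : (2 : ℝ) ^ n * (C * (1 / 2) ^ n) = C := by
    rw [mul_left_comm, ← mul_pow]; norm_num
  have h5 := mul_le_mul_of_nonneg_left h1 (by positivity : (0 : ℝ) ≤ 2 ^ n)
  rw [mul_inv_cancel_left₀ (by positivity), mul_sub, h4] at h5
  linarith

/-! # Counting conclusive measurements -/

/-- Distribution of the set of the `p` largest conclusive indices, when each index below `i` is
conclusive with probability `1 / 4` independently, and `I` are the conclusive indices from `i` on. -/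
noncomputable def pickDist (p : ℕ) : ℕ → Finset ℕ → Finset ℕ →₀ ℝ
  | 0, I => Finsupp.single I 1
  | i + 1, I => (1 / 4 : ℝ) • pickDist p i (if I.card < p then insert i I else I) +
      (3 / 4 : ℝ) • pickDist p i I

theorem pickDist_nonneg (p i : ℕ) (I J : Finset ℕ) : 0 ≤ pickDist p i I J := by
  induction i generalizing I with
  | zero => rw [pickDist, Finsupp.single_apply]; split_ifs <;> norm_num
  | succ i ih =>
    have h1 := ih I
    have h2 := ih (if I.card < p then insert i I else I)
    simp only [pickDist, Finsupp.add_apply, Finsupp.smul_apply, smul_eq_mul]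
    positivity

theorem sum_pickDist (p i : ℕ) (I : Finset ℕ) :
    Finsupp.linearCombination ℝ (fun _ => (1 : ℝ)) (pickDist p i I) = 1 := by
  induction i generalizing I with
  | zero => simp [pickDist]
  | succ i ih => rw [pickDist, map_add, map_smul, map_smul, ih, ih]; norm_num

theorem mem_support_pickDist {p i w : ℕ} {I J : Finset ℕ} (hi : i ≤ w)
    (hI : I ⊆ Finset.range w) (hp : I.card ≤ p) (hJ : J ∈ (pickDist p i I).support) :
    J ⊆ Finset.range w ∧ J.card ≤ p := by
  induction i generalizing I with
  | zero =>
    rw [pickDist] at hJ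
    have := Finset.mem_singleton.1 (Finsupp.support_single_subset hJ)
    subst this
    exact ⟨hI, hp⟩
  | succ i ih =>
    rw [pickDist] at hJ
    rcases Finset.mem_union.1 (Finsupp.support_add hJ) with h | h
    · refine ih (by omega) ?_ ?_ (Finsupp.support_smul h)
      · split_ifs
        · exact Finset.insert_subset (Finset.mem_range.2 (by omega)) hI
        · exact hI
      · split_ifs with hc
        · exact (Finset.card_insert_le _ _).trans hc
        · exact hp
    · exact ih (by omega) hI hp (Finsupp.support_smul h)

/-- Chernoff bound by a potential: each conclusive index halves `2 ^ (p - I.card)`, so one index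
multiplies the expectation by 1/4 · 1/2 + 3/4 = 7/8. The condition on `I` makes the next index new.
-/
theorem pickDist_card_lt_le (p i : ℕ) (I : Finset ℕ) (hI : ∀ j ∈ I, i ≤ j) :
    Finsupp.linearCombination ℝ (fun J : Finset ℕ => if J.card < p then (1 : ℝ) else 0)
      (pickDist p i I) ≤ if I.card < p then 2 ^ p * (1 / 2) ^ I.card * (7 / 8) ^ i else 0 := by
  induction i generalizing I with
  | zero =>
    simp only [pickDist, Finsupp.linearCombination_single, one_smul, pow_zero, mul_one]
    split_ifs with h
    · have : (2 : ℝ) ^ p * (1 / 2) ^ I.card = 2 ^ (p - I.card) := by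
        rw [← Nat.sub_add_cancel h.le, pow_add, mul_assoc, ← mul_pow]; norm_num
      rw [this]
      exact one_le_pow₀ (by norm_num)
    · exact le_rfl
  | succ i ih =>
    have h0 := ih I fun j hj => by have := hI j hj; omega
    rw [pickDist, map_add, map_smul, map_smul, smul_eq_mul, smul_eq_mul]
    by_cases h : I.card < p
    · have hi : i ∉ I := fun hi => by have := hI i hi; omega
      have h1 := ih (insert i I) fun j hj => by
        rcases Finset.mem_insert.1 hj with rfl | hj
        · exact le_rfl
        · have := hI j hj; omega
      rw [Finset.card_insert_of_notMem hi] at h1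
      simp only [h, if_true] at h0 ⊢
      have hA : (0 : ℝ) ≤ 2 ^ p * (1 / 2) ^ I.card * (7 / 8) ^ i := by positivity
      -- If the insertion completes the set, the bound is 0; it is weakened to the potential so that
      -- both cases read alike.
      have h2 := h1.trans (b := _) (c := 2 ^ p * (1 / 2) ^ (I.card + 1) * (7 / 8) ^ i)
        (by split_ifs
            · exact le_rfl
            · positivity)
      rw [pow_succ] at h2 ⊢
      nlinarith
    · simp only [h, if_false] at h0 ⊢
      linarith

theorem pickDist_fail_le (p : ℕ) :
    Finsupp.linearCombination ℝ (fun J : Finset ℕ => if J.card < p then (1 : ℝ) else 0)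
      (pickDist p (8 * p) ∅) ≤ (0.69 : ℝ) ^ p := by
  refine (pickDist_card_lt_le p (8 * p) ∅ (by simp)).trans ?_
  split_ifs
  -- Eight indices per required bit are enough because 2 · (7/8)^8 < 0.69 < 1.
  · rw [pow_mul, Finset.card_empty, pow_zero, mul_one, ← mul_pow]
    exact pow_le_pow_left₀ (by norm_num) (by norm_num) _
  · positivity

/-! # Uncertainty of the adversary -/

/-- Bit mask of length `w` of a set of indices. -/
def bitMask (w : ℕ) (I : Finset ℕ) : List Bool := (List.range w).map fun i => decide (i ∈ I)

theorem bitMask_length (w : ℕ) (I : Finset ℕ) : (bitMask w I).length = w := by simp [bitMask]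

theorem bitMask_injOn {w : ℕ} {I J : Finset ℕ} (hI : I ⊆ Finset.range w) (hJ : J ⊆ Finset.range w)
    (h : bitMask w I = bitMask w J) : I = J := by
  have h' : ∀ i < w, (i ∈ I ↔ i ∈ J) := fun i hi => by
    have := List.map_inj_left.1 h i (List.mem_range.2 hi)
    simpa using this
  ext i
  by_cases hi : i < w
  · exact h' i hi
  · exact ⟨fun h => absurd (Finset.mem_range.1 (hI h)) hi,
      fun h => absurd (Finset.mem_range.1 (hJ h)) hi⟩

/-- What the adversary sees, apart from the set `J` of conclusive indices: the output of the attack,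
or nothing if fewer than `m` indices are conclusive. -/
noncomputable def attackOrNothing (G : Generator) (P : Prog) (n m : ℕ) (J : Finset ℕ)
    (x : Fin n → Bool) : List Bool →₀ ℝ :=
  if J.card < m then Finsupp.single [] 1 else outDist (attackRun G P n (8 * m) J x)

theorem attackOrNothing_nonneg (G : Generator) (P : Prog) (n m : ℕ) (J : Finset ℕ)
    (x : Fin n → Bool) (w : List Bool) : 0 ≤ attackOrNothing G P n m J x w := by
  rw [attackOrNothing]
  split_ifs
  · rw [Finsupp.single_apply]; split_ifs <;> norm_num
  · exact outDist_nonneg _ _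

theorem mem_support_pickDist_empty {m : ℕ} {J : Finset ℕ}
    (hJ : J ∈ (pickDist m (8 * m) ∅).support) : J ⊆ Finset.range (8 * m) ∧ J.card ≤ m :=
  mem_support_pickDist le_rfl (by simp) (by simp) hJ

/-- All masks have length `8 * m`, so prepending the mask makes the outputs for different `J`
distinguishable and `condEntropy_mixture` applies. A failed selection leaves the full entropy `n`.
-/
theorem condEntropy_pick_le {G : Generator} {P : Prog} {n m : ℕ} {C : ℝ} (hC : 0 ≤ C)
    (h : ∀ I ⊆ Finset.range (8 * m), I.card = m →
      condEntropy (fun x => outDist (attackRun G P n (8 * m) I x)) ≤ C * (1 / 2) ^ n) :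
    condEntropy (fun x => Finsupp.linearCombination ℝ
      (fun J => Finsupp.mapDomain (bitMask (8 * m) J ++ ·) (attackOrNothing G P n m J x))
        (pickDist m (8 * m) ∅)) ≤ C * (1 / 2) ^ n + n * 0.69 ^ m := by
  set μ := pickDist m (8 * m) ∅
  have hmix := condEntropy_mixture μ.support (μ := μ) (e := fun J => (bitMask (8 * m) J ++ ·))
    (fun J hJ J' hJ' w w' he => by
      obtain ⟨h1, h2⟩ := List.append_inj he (by simp [bitMask_length])
      exact ⟨bitMask_injOn (mem_support_pickDist_empty hJ).1 (mem_support_pickDist_empty hJ').1 h1,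
        h2⟩) (fun J => attackOrNothing G P n m J)
  have hJ : ∀ J ∈ μ.support, condEntropy (attackOrNothing G P n m J) ≤
      C * (1 / 2) ^ n + n * if J.card < m then 1 else 0 := by
    intro J hJ
    by_cases hc : J.card < m
    · have : attackOrNothing G P n m J = fun _ => Finsupp.single [] 1 := by
        funext x; simp [attackOrNothing, hc]
      rw [this, condEntropy_single, if_pos hc]
      simp only [Fintype.card_fun, Fintype.card_bool, Fintype.card_fin, Nat.cast_pow,
        Nat.cast_ofNat, Real.logb_pow, Real.logb_self_eq_one (b := 2) (by norm_num)]
      have : 0 ≤ C * (1 / 2) ^ n := by positivity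
      linarith
    · have : attackOrNothing G P n m J = fun x => outDist (attackRun G P n (8 * m) J x) := by
        funext x; simp [attackOrNothing, hc]
      obtain ⟨h1, h2⟩ := mem_support_pickDist_empty hJ
      rw [this, if_neg hc]
      simpa using h J h1 (by omega)
  have hsum := sum_pickDist m (8 * m) ∅
  have hfail := pickDist_fail_le m
  rw [Finsupp.linearCombination_apply, Finsupp.sum] at hsum hfail
  simp only [Finsupp.linearCombination_apply, Finsupp.sum]
  rw [hmix]
  calc _ ≤ ∑ J ∈ μ.support, μ J * (C * (1 / 2) ^ n + n * if J.card < m then 1 else 0) :=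
        Finset.sum_le_sum fun J hJs =>
          mul_le_mul_of_nonneg_left (hJ J hJs) (pickDist_nonneg _ _ _ _)
    _ = C * (1 / 2) ^ n * (∑ J ∈ μ.support, μ J • (1 : ℝ)) +
        n * ∑ J ∈ μ.support, μ J • (if J.card < m then (1 : ℝ) else 0) := by
        rw [Finset.mul_sum, Finset.mul_sum, ← Finset.sum_add_distrib]
        refine Finset.sum_congr rfl fun J _ => ?_
        simp only [smul_eq_mul]; ring
    _ ≤ _ := by
        rw [hsum, mul_one]
        exact add_le_add le_rfl (mul_le_mul_of_nonneg_left hfail (by positivity))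

/-- The guessing probability is linear in the output law, so the set `J` need not be output here; a
failed selection costs at most its probability. -/
theorem le_guessProb_pick {G : Generator} {P : Prog} {n m : ℕ} {C : ℝ} (hC : 0 ≤ C)
    (h : ∀ I ⊆ Finset.range (8 * m), I.card = m →
      1 - C * (1 / 2) ^ n ≤ guessProb (fun x => outDist (attackRun G P n (8 * m) I x))) :
    1 - (C * (1 / 2) ^ n + 0.69 ^ m) ≤ guessProb (fun x => Finsupp.linearCombination ℝ
      (fun J => attackOrNothing G P n m J x) (pickDist m (8 * m) ∅)) := by
  set μ := pickDist m (8 * m) ∅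
  have hJ : ∀ J ∈ μ.support, 1 - C * (1 / 2) ^ n - (if J.card < m then 1 else 0) ≤
      guessProb (attackOrNothing G P n m J) := by
    intro J hJ
    by_cases hc : J.card < m
    · have h0 : 0 ≤ guessProb (attackOrNothing G P n m J) :=
        mul_nonneg (by positivity) (Finset.sum_nonneg fun x _ => attackOrNothing_nonneg ..)
      have : 0 ≤ C * (1 / 2) ^ n := by positivity
      rw [if_pos hc]
      linarith
    · have : attackOrNothing G P n m J = fun x => outDist (attackRun G P n (8 * m) J x) := by
        funext x; simp [attackOrNothing, hc]
      obtain ⟨h1, h2⟩ := mem_support_pickDist_empty hJ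
      rw [this, if_neg hc]
      simpa using h J h1 (by omega)
  have hsum := sum_pickDist m (8 * m) ∅
  have hfail := pickDist_fail_le m
  rw [Finsupp.linearCombination_apply, Finsupp.sum] at hsum hfail
  have hg : guessProb (fun x => Finsupp.linearCombination ℝ
      (fun J => attackOrNothing G P n m J x) μ) =
      ∑ J ∈ μ.support, μ J * guessProb (attackOrNothing G P n m J) := by
    simp only [guessProb, Finsupp.linearCombination_apply, Finsupp.sum, Finsupp.finsetSum_apply,
      Finsupp.smul_apply, smul_eq_mul]
    rw [Finset.sum_comm, Finset.mul_sum]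
    refine Finset.sum_congr rfl fun J _ => ?_
    rw [← Finset.mul_sum]; ring
  rw [hg]
  calc 1 - (C * (1 / 2) ^ n + 0.69 ^ m)
      ≤ (1 - C * (1 / 2) ^ n) * (∑ J ∈ μ.support, μ J • (1 : ℝ)) -
        ∑ J ∈ μ.support, μ J • (if J.card < m then (1 : ℝ) else 0) := by
        rw [hsum]; linarith
    _ = ∑ J ∈ μ.support, μ J * (1 - C * (1 / 2) ^ n - if J.card < m then 1 else 0) := by
        rw [Finset.mul_sum, ← Finset.sum_sub_distrib]
        refine Finset.sum_congr rfl fun J _ => ?_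
        simp only [smul_eq_mul]; ring
    _ ≤ _ := Finset.sum_le_sum fun J hJs =>
          mul_le_mul_of_nonneg_left (hJ J hJs) (pickDist_nonneg _ _ _ _)

theorem pow_le_rpow_quarter {a : ℝ} (h0 : 0 ≤ a) (h1 : a ≤ 0.76) (n : ℕ) :
    a ^ n ≤ (2 : ℝ) ^ (-((1 / 4 : ℝ) * n)) := by
  rw [← neg_mul, Real.rpow_mul (by norm_num), Real.rpow_natCast]
  refine pow_le_pow_left₀ h0 (h1.trans ?_) n
  -- Fourth powers are compared: 0.76^4 < 1/2. This is what permits the rate `c = 1 / 4`.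
  have h4 : ((2 : ℝ) ^ (-(1 / 4 : ℝ))) ^ 4 = 1 / 2 := by
    rw [← Real.rpow_natCast, ← Real.rpow_mul (by norm_num)]
    norm_num [Real.rpow_neg_one]
  refine le_of_pow_le_pow_left₀ (n := 4) (by norm_num) (by positivity) ?_
  rw [h4]
  norm_num

/-- For `m ≥ n` the power decreases. For `m < n` the left side is at most 1, and 1 ≤ (2 · 0.69)^n ≤
2C · 0.69^n. -/
theorem fail_pow_le {C : ℝ} (hC : 0 ≤ C) {n m : ℕ} (h : m < n → (2 : ℝ) ^ n ≤ 2 * C) :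
    (0.69 : ℝ) ^ m ≤ (1 + 2 * C) * 0.69 ^ n := by
  rcases lt_or_ge m n with hm | hm
  · have h1 : (0.69 : ℝ) ^ m ≤ 1 := pow_le_one₀ (by norm_num) (by norm_num)
    have h2 : (1 : ℝ) ≤ 2 * C * 0.69 ^ n := by
      calc (1 : ℝ) ≤ (2 * 0.69) ^ n := one_le_pow₀ (by norm_num)
        _ = 2 ^ n * 0.69 ^ n := mul_pow ..
        _ ≤ _ := mul_le_mul_of_nonneg_right (h hm) (by positivity)
    have h3 : (0 : ℝ) ≤ 0.69 ^ n := by positivity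
    linarith
  · have h1 : (0.69 : ℝ) ^ m ≤ 0.69 ^ n := pow_le_pow_of_le_one (by norm_num) (by norm_num) hm
    have h2 : (0 : ℝ) ≤ 2 * C * 0.69 ^ n := by positivity
    linarith

theorem fail_le {C : ℝ} (hC : 0 ≤ C) {n m : ℕ} (h : m < n → (2 : ℝ) ^ n ≤ 2 * C) :
    C * (1 / 2) ^ n + 0.69 ^ m ≤ (1 + 3 * C) * (2 : ℝ) ^ (-((1 / 4 : ℝ) * n)) := by
  have h1 := fail_pow_le hC h
  have h2 := pow_le_rpow_quarter (a := 1 / 2) (by norm_num) (by norm_num) n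
  have h3 := pow_le_rpow_quarter (a := 0.69) (by norm_num) (by norm_num) n
  nlinarith

theorem mul_fail_le {C : ℝ} (hC : 0 ≤ C) {n m : ℕ} (h : m < n → (2 : ℝ) ^ n ≤ 2 * C) :
    C * (1 / 2) ^ n + n * 0.69 ^ m ≤ (10 + 21 * C) * (2 : ℝ) ^ (-((1 / 4 : ℝ) * n)) := by
  have h1 := fail_pow_le hC h
  have h2 := pow_le_rpow_quarter (a := 1 / 2) (by norm_num) (by norm_num) n
  have h3 := pow_le_rpow_quarter (a := 1.1 * 0.69) (by norm_num) (by norm_num) n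
  -- Bernoulli's inequality. The factor `n` is absorbed by enlarging the base 0.69 to 1.1 · 0.69 =
  -- 0.759, still below 0.76.
  have h4 : (n : ℝ) ≤ 10 * 1.1 ^ n := by
    have := one_add_mul_le_pow (a := (0.1 : ℝ)) (by norm_num) n
    norm_num at this ⊢
    linarith
  have h5 : (n : ℝ) * 0.69 ^ n ≤ 10 * (1.1 * 0.69) ^ n := by
    rw [mul_pow, ← mul_assoc]
    exact mul_le_mul_of_nonneg_right h4 (by positivity)
  have h6 : (n : ℝ) * 0.69 ^ m ≤ (1 + 2 * C) * (n * 0.69 ^ n) := by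
    rw [mul_left_comm]
    exact mul_le_mul_of_nonneg_left h1 (by positivity)
  nlinarith

/-! # Sampling semantics of program fragments -/

/-- Contents of the stacks together with the state of the qubits. -/
abbrev MState : Type := (ℕ → List Bool) × QState

/-- The configuration with clock `0`. -/
def MState.start (s : MState) : Config := ⟨s.1, s.2, 0⟩

/-- Commutes with scaling the state of the qubits and shifting the clock. -/
def Equivariant (f : Config → List Config) : Prop :=
  ∀ a t c, f (c.scale a t) = (f c).map (Config.scale a t)

/-- Quadratic in the state of the qubits and independent of the clock. -/
def Quadratic {V : Type*} [AddCommGroup V] [Module ℝ V] (F : Config → V) : Prop :=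
  ∀ a t c, F (c.scale a t) = ‖a‖ ^ 2 • F c

theorem Prog.equivariant (O : List Bool → List Bool) (P : Prog) : Equivariant (P.run O) :=
  fun a t c => P.run_scale O a t c

/-- Started in `s` at time `0`, the computation `f` ends within `B` steps, up to a scalar in a random
state with distribution `ν`. -/
structure Samples (f : Config → List Config) (s : MState) (ν : MState →₀ ℝ) (B : ℕ) : Prop where
  sum : ∀ F : Config → (List Bool →₀ ℝ), Quadratic F →
    ((f s.start).map F).sum = Finsupp.linearCombination ℝ (fun s' => F s'.start) ν
  bound : ∀ c ∈ f s.start, c.psi ≠ 0 → c.time ≤ B ∧ ∃ s' ∈ ν.support, ∃ a : ℂ,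
    c.reg = s'.1 ∧ c.psi = a • s'.2
  nonneg : ∀ s', 0 ≤ ν s'

theorem linearCombination_nonneg {ι κ : Type*} {ν : ι →₀ ℝ} {ν' : ι → κ →₀ ℝ}
    (h : ∀ i, 0 ≤ ν i) (h' : ∀ i ∈ ν.support, ∀ k, 0 ≤ ν' i k) (k : κ) :
    0 ≤ Finsupp.linearCombination ℝ ν' ν k := by
  rw [Finsupp.linearCombination_apply, Finsupp.sum, Finsupp.finsetSum_apply]
  exact Finset.sum_nonneg fun i hi => mul_nonneg (h i) (h' i hi k)

theorem mem_support_linearCombination {ι κ : Type*} {ν : ι →₀ ℝ} {ν' : ι → κ →₀ ℝ}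
    (h : ∀ i, 0 ≤ ν i) (h' : ∀ i ∈ ν.support, ∀ k, 0 ≤ ν' i k) {i : ι} {k : κ}
    (hi : i ∈ ν.support) (hk : k ∈ (ν' i).support) :
    k ∈ (Finsupp.linearCombination ℝ ν' ν).support := by
  rw [Finsupp.mem_support_iff, Finsupp.linearCombination_apply, Finsupp.sum,
    Finsupp.finsetSum_apply]
  refine ne_of_gt (Finset.sum_pos' (fun j hj => mul_nonneg (h j) (h' j hj k)) ⟨i, hi, ?_⟩)
  exact mul_pos (lt_of_le_of_ne (h i) (Ne.symm (Finsupp.mem_support_iff.1 hi)))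
    (lt_of_le_of_ne (h' i hi k) (Ne.symm (Finsupp.mem_support_iff.1 hk)))

namespace Samples

variable {f g : Config → List Config} {s s' : MState} {ν : MState →₀ ℝ} {B B' : ℕ}

theorem mono (h : Samples f s ν B) (hB : B ≤ B') : Samples f s ν B' :=
  ⟨h.sum, fun c hc h0 => ⟨(h.bound c hc h0).1.trans hB, (h.bound c hc h0).2⟩, h.nonneg⟩

theorem _root_.Config.eq_scale_start {c : Config} {s : MState} {a : ℂ} (h1 : c.reg = s.1)
    (h2 : c.psi = a • s.2) : c = s.start.scale a c.time := by
  rw [Config.scale_eq]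
  cases c
  simp_all [MState.start]

/-- Each nonzero branch after `f` is a scalar multiple of some `s'` in the support with shifted
clock, and `g` commutes with both changes, so its behaviour on `s'` at time 0 suffices. Nonnegative
weights rule out cancellation in the support of the composed law. -/
theorem bind {ν' : MState → MState →₀ ℝ} (hg : Equivariant g)
    (hg0 : ∀ c, c.psi = 0 → ∀ d ∈ g c, d.psi = 0)
    (h : Samples f s ν B) (h' : ∀ s' ∈ ν.support, Samples g s' (ν' s') B') :
    Samples (fun c => (f c).flatMap g) s (Finsupp.linearCombination ℝ ν' ν) (B + B') where
  sum F hF := by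
    rw [List.sum_map_flatMap, h.sum (fun c => ((g c).map F).sum) ?_]
    · rw [Finsupp.apply_linearCombination]
      simp only [Finsupp.linearCombination_apply, Finsupp.sum]
      refine Finset.sum_congr rfl fun s' hs' => ?_
      rw [(h' s' hs').sum F hF]
      simp [Finsupp.linearCombination_apply, Finsupp.sum]
    · intro a t c
      simp only [hg a t c, List.map_map]
      have : F ∘ Config.scale a t = fun c => ‖a‖ ^ 2 • F c := funext fun c => hF a t c
      rw [this, List.smul_sum, List.map_map]
      rfl
  bound d hd hd0 := by
    obtain ⟨c, hc, hdc⟩ := List.mem_flatMap.1 hd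
    have hc0 : c.psi ≠ 0 := fun h0 => hd0 (hg0 c h0 d hdc)
    obtain ⟨hct, s', hs', a, ha1, ha2⟩ := h.bound c hc hc0
    rw [Config.eq_scale_start ha1 ha2, hg] at hdc
    obtain ⟨e, he, rfl⟩ := List.mem_map.1 hdc
    have he0 : e.psi ≠ 0 := fun h0 => hd0 (by simp [Config.modify, h0])
    obtain ⟨het, s'', hs'', b, hb1, hb2⟩ := (h' s' hs').bound e he he0
    refine ⟨?_, s'', mem_support_linearCombination h.nonneg (fun i hi => (h' i hi).nonneg) hs' hs'',
      a * b, ?_, ?_⟩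
    · simp only [Config.modify]; omega
    · simpa [Config.modify] using hb1
    · simp [Config.modify, hb2, mul_smul]
  nonneg := linearCombination_nonneg h.nonneg fun i hi => (h' i hi).nonneg

theorem pure {t : ℕ} {a : ℂ} (ha : ‖a‖ = 1)
    (h : f s.start = [⟨s'.1, a • s'.2, t⟩]) (ht : t ≤ B) :
    Samples f s (Finsupp.single s' 1) B where
  sum F hF := by
    have := hF a t s'.start
    rw [Config.scale_eq, ha, one_pow, one_smul] at this
    simp only [h, List.map_cons, List.map_nil, List.sum_cons, List.sum_nil, add_zero,
      Finsupp.linearCombination_single, one_smul]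
    rw [← this]
    simp [MState.start]
  bound c hc _ := by
    rw [h, List.mem_singleton] at hc
    subst hc
    exact ⟨ht, s', by simp, a, rfl, rfl⟩
  nonneg s'' := by
    classical
    rw [Finsupp.single_apply]; split_ifs <;> norm_num

theorem pair {s₀ s₁ : MState} {t₀ t₁ : ℕ} {a₀ a₁ : ℂ}
    (h : f s.start = [⟨s₀.1, a₀ • s₀.2, t₀⟩, ⟨s₁.1, a₁ • s₁.2, t₁⟩]) (h₀ : t₀ ≤ B) (h₁ : t₁ ≤ B) :
    Samples f s (Finsupp.single s₀ (‖a₀‖ ^ 2) + Finsupp.single s₁ (‖a₁‖ ^ 2)) B := by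
  classical
  have hnn : ∀ (s' s'' : MState) (a : ℂ), 0 ≤ Finsupp.single s' (‖a‖ ^ 2) s'' := fun s' s'' a => by
    rw [Finsupp.single_apply]; split_ifs <;> positivity
  refine ⟨fun F hF => ?_, fun c hc h0 => ?_, fun s' => add_nonneg (hnn _ _ _) (hnn _ _ _)⟩
  · have e0 := hF a₀ t₀ s₀.start
    have e1 := hF a₁ t₁ s₁.start
    rw [Config.scale_eq] at e0 e1
    simp only [h, List.map_cons, List.map_nil, List.sum_cons, List.sum_nil, add_zero, map_add,
      Finsupp.linearCombination_single]
    rw [← e0, ← e1]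
    simp [MState.start]
  · rw [h] at hc
    simp only [List.mem_cons, List.not_mem_nil, or_false] at hc
    rcases hc with rfl | rfl
    · refine ⟨h₀, s₀, ?_, a₀, rfl, rfl⟩
      have ha : a₀ ≠ 0 := fun ha => h0 (by simp [ha])
      -- The two states may coincide, so the weight here is a sum, positive because the other term
      -- is nonnegative.
      rw [Finsupp.mem_support_iff, Finsupp.add_apply, Finsupp.single_eq_same]
      have := hnn s₁ s₀ a₁
      positivity
    · refine ⟨h₁, s₁, ?_, a₁, rfl, rfl⟩
      have ha : a₁ ≠ 0 := fun ha => h0 (by simp [ha])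
      rw [Finsupp.mem_support_iff, Finsupp.add_apply, Finsupp.single_eq_same (a := s₁)]
      have := hnn s₀ s₁ a₀
      positivity

end Samples

/-- `Samples` for a program. -/
abbrev Prog.Samples (O : List Bool → List Bool) (P : Prog) (s : MState) (ν : MState →₀ ℝ) (B : ℕ) :
    Prop :=
  _root_.Samples (P.run O) s ν B

theorem Prog.Samples.mono {O : List Bool → List Bool} {P : Prog} {s : MState} {ν : MState →₀ ℝ}
    {B B' : ℕ} (h : P.Samples O s ν B) (hB : B ≤ B') : P.Samples O s ν B' :=
  _root_.Samples.mono h hB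

theorem Prog.Samples.seq {O : List Bool → List Bool} {P Q : Prog} {s : MState} {ν : MState →₀ ℝ}
    {ν' : MState → MState →₀ ℝ} {B B' : ℕ} (h : P.Samples O s ν B)
    (h' : ∀ s' ∈ ν.support, Q.Samples O s' (ν' s') B') :
    (Prog.seq P Q).Samples O s (Finsupp.linearCombination ℝ ν' ν) (B + B') :=
  Samples.bind (Prog.equivariant O Q) (fun _ hc _ hd => Prog.psi_eq_zero_of_mem_run hc hd) h h'

theorem Prog.Samples.seq_single {O : List Bool → List Bool} {P Q : Prog} {s s' : MState}
    {ν' : MState →₀ ℝ} {B B' : ℕ} (h : P.Samples O s (Finsupp.single s' 1) B)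
    (h' : Q.Samples O s' ν' B') : (Prog.seq P Q).Samples O s ν' (B + B') := by
  have := Prog.Samples.seq (ν' := fun _ => ν') h fun s'' hs'' => by
    rw [Finset.mem_singleton.1 (Finsupp.support_single_subset hs'')]; exact h'
  simpa using this

theorem Samples.tick {f g : Config → List Config} {s : MState} {ν : MState →₀ ℝ} {B : ℕ} (t : ℕ)
    (hg : Equivariant g) (h : Samples g s ν B) (hf : f s.start = g (s.start.tick t)) :
    Samples f s ν (B + t) := by
  have e : s.start.tick t = s.start.scale 1 t := by
    simp [Config.scale_eq, Config.tick]
  rw [e, hg] at hf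
  refine ⟨fun F hF => ?_, fun c hc h0 => ?_, h.nonneg⟩
  · rw [hf, List.map_map, ← h.sum F hF]
    congr 2
    funext c
    simpa using hF 1 t c
  · rw [hf] at hc
    obtain ⟨d, hd, rfl⟩ := List.mem_map.1 hc
    obtain ⟨h1, s', hs', a, ha1, ha2⟩ := h.bound d hd fun hd0 => h0 (by simp [Config.modify, hd0])
    exact ⟨Nat.add_le_add_right h1 t, s', hs', a, ha1, by simp [Config.modify, ha2]⟩

/-- All branches of `k` runs of `Q` in a row. -/
noncomputable def Prog.iter (O : List Bool → List Bool) (Q : Prog) (k : ℕ) (c : Config) :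
    List Config :=
  (fun L : List Config => L.flatMap fun c' => Q.run O c')^[k] [c]

theorem List.iterate_flatMap_eq {α : Type*} (f : α → List α) (k : ℕ) (L : List α) :
    (fun L : List α => L.flatMap f)^[k] L =
      L.flatMap fun c => (fun L : List α => L.flatMap f)^[k] [c] := by
  induction k generalizing L with
  | zero => simp
  | succ k ih =>
    simp only [Function.iterate_succ, Function.comp_apply, List.flatMap_singleton]
    rw [ih, List.flatMap_assoc]
    congr 1
    funext c
    exact (ih (f c)).symm

theorem Prog.iter_succ (O : List Bool → List Bool) (Q : Prog) (k : ℕ) (c : Config) :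
    Q.iter O (k + 1) c = (Q.run O c).flatMap (Q.iter O k) := by
  simp only [Prog.iter, Function.iterate_succ, Function.comp_apply, List.flatMap_singleton]
  exact List.iterate_flatMap_eq _ k _

theorem Prog.iter_equivariant (O : List Bool → List Bool) (Q : Prog) (k : ℕ) :
    Equivariant (Q.iter O k) := fun a t c =>
  List.iterate_flatMap_map (fun c => Q.run_scale O a t c) k [c]

theorem Prog.psi_eq_zero_of_mem_iter {O : List Bool → List Bool} {Q : Prog} {k : ℕ} {c d : Config}
    (hc : c.psi = 0) (hd : d ∈ Q.iter O k c) : d.psi = 0 := by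
  induction k generalizing c with
  | zero => simp only [Prog.iter, Function.iterate_zero, id, List.mem_singleton] at hd; rwa [hd]
  | succ k ih =>
    rw [Prog.iter_succ] at hd
    obtain ⟨e, he, hd⟩ := List.mem_flatMap.1 hd
    exact ih (Prog.psi_eq_zero_of_mem_run hc he) hd

namespace Prog.Samples

variable {O : List Bool → List Bool} {Q : Prog} {s : MState} {ν : MState →₀ ℝ} {B B' : ℕ}

theorem iter_zero : _root_.Samples (Q.iter O 0) s (Finsupp.single s 1) 0 :=
  _root_.Samples.pure (a := 1) (t := 0) (by simp) (by simp [Prog.iter, MState.start]) le_rfl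

theorem iter_succ {k : ℕ} {ν' : MState → MState →₀ ℝ} (h : Q.Samples O s ν B)
    (h' : ∀ s' ∈ ν.support, _root_.Samples (Q.iter O k) s' (ν' s') B') :
    _root_.Samples (Q.iter O (k + 1)) s (Finsupp.linearCombination ℝ ν' ν) (B + B') := by
  have e : Q.iter O (k + 1) = fun c => (Q.run O c).flatMap (Q.iter O k) :=
    funext fun c => Prog.iter_succ O Q k c
  rw [e]
  exact _root_.Samples.bind (Prog.iter_equivariant O Q k)
    (fun _ hc _ hd => Prog.psi_eq_zero_of_mem_iter hc hd) h h'

theorem loop {r k : ℕ} (hk : (s.1 r).length = k) (h : _root_.Samples (Q.iter O k) s ν B) :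
    (Prog.loop r Q).Samples O s ν (B + 1) :=
  Samples.tick 1 (Prog.iter_equivariant O Q k) h (by subst hk; rfl)

theorem loop_down {r k : ℕ} (st : ℕ → MState) (hk : ((st k).1 r).length = k)
    (h : ∀ i < k, Q.Samples O (st (i + 1)) (Finsupp.single (st i) 1) B) :
    (Prog.loop r Q).Samples O (st k) (Finsupp.single (st 0) 1) (k * B + 1) := by
  refine loop hk ?_
  clear hk
  induction k with
  | zero => simpa using iter_zero
  | succ k ih =>
    have := iter_succ (h k (Nat.lt_succ_self k))
      (ν' := fun _ => Finsupp.single (st 0) 1) (k := k) (B' := k * B) fun s' hs' => by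
        rw [Finset.mem_singleton.1 (Finsupp.support_single_subset hs')]
        exact ih fun i hi => h i (by omega)
    simpa [Nat.succ_mul, Nat.add_comm] using this

theorem loop_up {r k : ℕ} (st : ℕ → MState) (hk : ((st 0).1 r).length = k)
    (h : ∀ i < k, Q.Samples O (st i) (Finsupp.single (st (i + 1)) 1) B) :
    (Prog.loop r Q).Samples O (st 0) (Finsupp.single (st k) 1) (k * B + 1) := by
  have := loop_down (O := O) (Q := Q) (r := r) (k := k) (B := B) (fun i => st (k - i))
    (by simpa using hk) fun i hi => by
      have e : k - i = k - (i + 1) + 1 := by omega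
      simp only [e]
      exact h _ (by omega)
  simpa using this

variable {R : ℕ → List Bool} {ψ : QState} {r : ℕ}

theorem skip : Prog.skip.Samples O s (Finsupp.single s 1) 1 :=
  _root_.Samples.pure (a := 1) (t := 1) (by simp)
    (by simp [Prog.run, Config.tick, MState.start]) le_rfl

theorem push (r : ℕ) (b : Bool) : (Prog.push r b).Samples O (R, ψ)
    (Finsupp.single (Function.update R r (b :: R r), ψ) 1) 1 :=
  _root_.Samples.pure (a := 1) (t := 1) (by simp)
    (by simp [Prog.run, Config.tick, Config.set, MState.start]) le_rfl

theorem pop (r : ℕ) : (Prog.pop r).Samples O (R, ψ)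
    (Finsupp.single (Function.update R r (R r).tail, ψ) 1) 1 :=
  _root_.Samples.pure (a := 1) (t := 1) (by simp)
    (by simp [Prog.run, Config.tick, Config.set, MState.start]) le_rfl

theorem oracle (r s : ℕ) : (Prog.oracle r s).Samples O (R, ψ)
    (Finsupp.single (Function.update R s (O (R r)), ψ) 1)
    (1 + (R r).length + (O (R r)).length) :=
  _root_.Samples.pure (a := 1) (t := 1 + (R r).length + (O (R r)).length) (by simp)
    (by simp [Prog.run, Config.tick, Config.set, MState.start]) le_rfl

theorem gateH (r : ℕ) : (Prog.gateH r).Samples O (R, ψ)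
    (Finsupp.single (R, QState.gateH (R r).length ψ) 1) 1 :=
  _root_.Samples.pure (a := 1) (t := 1) (by simp)
    (by simp [Prog.run, Config.tick, Config.apply, MState.start]) le_rfl

theorem cases_false {P₀ P₁ P₂ : Prog} {l : List Bool} (hr : s.1 r = false :: l)
    (h : P₁.Samples O s ν B) : (Prog.cases r P₀ P₁ P₂).Samples O s ν (B + 1) :=
  Samples.tick 1 (Prog.equivariant O P₁) h (by simp only [Prog.run, MState.start, hr])

theorem cases_true {P₀ P₁ P₂ : Prog} {l : List Bool} (hr : s.1 r = true :: l)
    (h : P₂.Samples O s ν B) : (Prog.cases r P₀ P₁ P₂).Samples O s ν (B + 1) :=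
  Samples.tick 1 (Prog.equivariant O P₂) h (by simp only [Prog.run, MState.start, hr])

theorem of_eq {s' s'' : MState} {P : Prog} (h : P.Samples O s (Finsupp.single s' 1) B) (e : s' = s'') :
    P.Samples O s (Finsupp.single s'' 1) B := e ▸ h

end Prog.Samples

/-! # Moving bits between stacks -/

/-- Move the top of stack `r` to stack `s`. -/
def Prog.moveOne (r s : ℕ) : Prog :=
  .seq (.cases r .skip (.push s false) (.push s true)) (.pop r)

/-- Empty stack `r`. -/
def Prog.clear (r : ℕ) : Prog := .loop r (.pop r)

section Move

variable {O : List Bool → List Bool} {R : ℕ → List Bool} {ψ : QState} {r s : ℕ}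

theorem Prog.samples_moveOne (hrs : r ≠ s) {b : Bool} {l : List Bool} (hr : R r = b :: l) :
    (Prog.moveOne r s).Samples O (R, ψ)
      (Finsupp.single (Function.update (Function.update R s (b :: R s)) r l, ψ) 1) 3 := by
  refine Prog.Samples.seq_single (s' := (Function.update R s (b :: R s), ψ)) (B := 2) (B' := 1) ?_ ?_
  · cases b
    · exact Prog.Samples.cases_false hr (Prog.Samples.push s false)
    · exact Prog.Samples.cases_true hr (Prog.Samples.push s true)
  · refine (Prog.Samples.pop r).of_eq ?_
    rw [Function.update_of_ne hrs, hr, List.tail_cons]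

/-- Moving bits one at a time reverses them. The controlling stack `a` may be `r` itself, since the
number of iterations is fixed when the loop is entered. -/
theorem Prog.samples_move (hrs : r ≠ s) {a k : ℕ} (ha : (R a).length = k) (hk : k ≤ (R r).length) :
    (Prog.loop a (Prog.moveOne r s)).Samples O (R, ψ)
      (Finsupp.single (Function.update (Function.update R s (((R r).take k).reverse ++ R s)) r
        ((R r).drop k), ψ) 1) (k * 3 + 1) := by
  have := Prog.Samples.loop_up (O := O) (Q := Prog.moveOne r s) (r := a) (k := k) (B := 3)
    (fun i => (Function.update (Function.update R s (((R r).take i).reverse ++ R s)) r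
        ((R r).drop i), ψ)) (by simpa using ha) fun i hi => by
      have hi' : i < (R r).length := by omega
      refine (Prog.samples_moveOne hrs (b := (R r)[i]) (l := (R r).drop (i + 1)) ?_).of_eq ?_
      · simp only [Function.update_self]
        exact List.drop_eq_getElem_cons hi'
      · simp only [Prod.mk.injEq, and_true]
        funext j
        by_cases hj : j = r
        · subst hj; simp
        · by_cases hjs : j = s
          · subst hjs
            rw [Function.update_of_ne hj, Function.update_of_ne hj, Function.update_self,
              Function.update_self, Function.update_of_ne hj, Function.update_self,
              List.take_succ_eq_append_getElem hi', List.reverse_append, List.reverse_singleton]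
            rfl
          · simp [Function.update_of_ne hj, Function.update_of_ne hjs]
  simpa using this

theorem Prog.samples_clear : (Prog.clear r).Samples O (R, ψ)
    (Finsupp.single (Function.update R r [], ψ) 1) ((R r).length + 1) := by
  have := Prog.Samples.loop_up (O := O) (Q := Prog.pop r) (r := r) (k := (R r).length) (B := 1)
    (fun i => (Function.update R r ((R r).drop i), ψ)) (by simp) fun i _ =>
      (Prog.Samples.pop r).of_eq (by simp [List.tail_drop])
  simpa [Prog.clear] using this

/-! # Polynomials in unary -/

/-- A monomial is `k` nested loops over stack 1 around `a` pushes; `r ≠ 1` keeps the loop counts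
intact. -/
theorem exists_prog_unary_mul_pow (r k a : ℕ) (hr : r ≠ 1) : ∃ (P : Prog) (q : Polynomial ℕ),
    ∀ O R ψ, P.Samples O (R, ψ) (Finsupp.single (Function.update R r
      (unary (a * (R 1).length ^ k) ++ R r), ψ) 1) (q.eval (R 1).length) := by
  induction k with
  | zero =>
    induction a with
    | zero => exact ⟨.skip, 1, fun O R ψ => by simpa [unary] using Prog.Samples.skip⟩
    | succ a ih =>
      obtain ⟨P, q, h⟩ := ih
      refine ⟨.seq P (.push r true), q + 1, fun O R ψ => ?_⟩
      rw [Polynomial.eval_add, Polynomial.eval_one]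
      refine (h O R ψ).seq_single ((Prog.Samples.push r true).of_eq ?_)
      simp [unary, List.replicate_succ]
  | succ k ih =>
    obtain ⟨P, q, h⟩ := ih
    refine ⟨.loop 1 P, Polynomial.X * q + 1, fun O R ψ => ?_⟩
    have := Prog.Samples.loop_up (O := O) (Q := P) (r := 1) (k := (R 1).length)
      (B := q.eval (R 1).length)
      (fun i => (Function.update R r (unary (i * (a * (R 1).length ^ k)) ++ R r), ψ))
      (by simp [unary]) fun i _ => by
        have h1 := h O (Function.update R r (unary (i * (a * (R 1).length ^ k)) ++ R r)) ψ
        rw [Function.update_of_ne (Ne.symm hr)] at h1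
        refine h1.of_eq ?_
        simp only [Function.update_idem, Function.update_self, Prod.mk.injEq, and_true]
        congr 1
        rw [← List.append_assoc]
        simp only [unary, List.replicate_append_replicate]
        congr 2
        ring
    have e : (R 1).length * (a * (R 1).length ^ k) = a * (R 1).length ^ (k + 1) := by ring
    simpa [unary, e] using this

theorem exists_prog_unary_eval (p : Polynomial ℕ) (r : ℕ) (hr : r ≠ 1) :
    ∃ (P : Prog) (q : Polynomial ℕ), ∀ O R ψ, P.Samples O (R, ψ)
      (Finsupp.single (Function.update R r (unary (p.eval (R 1).length) ++ R r), ψ) 1)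
      (q.eval (R 1).length) := by
  induction p using Polynomial.induction_on' with
  | add p p' hp hp' =>
    obtain ⟨P, q, h⟩ := hp
    obtain ⟨P', q', h'⟩ := hp'
    refine ⟨.seq P P', q + q', fun O R ψ => ?_⟩
    rw [Polynomial.eval_add (p := q)]
    have h1 := h' O (Function.update R r (unary (p.eval (R 1).length) ++ R r)) ψ
    rw [Function.update_of_ne (Ne.symm hr)] at h1
    refine (h O R ψ).seq_single (h1.of_eq ?_)
    simp only [Function.update_idem, Function.update_self, Polynomial.eval_add]
    rw [← List.append_assoc]
    simp only [unary, List.replicate_append_replicate, Nat.add_comm]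
  | monomial k a =>
    obtain ⟨P, q, h⟩ := exists_prog_unary_mul_pow r k a hr
    exact ⟨P, q, fun O R ψ => by simpa using h O R ψ⟩

end Move

/-! # Measuring the tag qubits -/

/-- Stacks with the contents listed in `L`, all other stacks being empty. -/
def stackFile (L : List (List Bool)) (r : ℕ) : List Bool := L.getD r []

theorem update_stackFile {L : List (List Bool)} {r : ℕ} (h : r < L.length) (x : List Bool) :
    Function.update (stackFile L) r x = stackFile (L.set r x) := by
  funext j
  by_cases hj : j = r
  · subst hj; simp [stackFile, List.getD_eq_getElem?_getD, h]
  · simp [stackFile, List.getD_eq_getElem?_getD, Function.update_of_ne hj,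
      List.getElem?_set_ne (Ne.symm hj)]

/-- Measure the qubit addressed by stack `q`, push the outcome on stack `s`, and put the qubit in
state `|0⟩`. -/
def Prog.measureReset (q s : ℕ) : Prog :=
  .seq (.measure q s) (.cases s .skip .skip (.gateX q))

/-- After the reset both outcomes leave a multiple of the same `ψ`, so the measurement amounts to a
classical random bit with weights `‖v₀‖ ^ 2` and `‖v₁‖ ^ 2`. -/
theorem Prog.samples_measureReset {O : List Bool → List Bool} {R : ℕ → List Bool} {ψ : QState}
    {q s i : ℕ} {v₀ v₁ : ℂ} (hqs : q ≠ s) (hi : (R q).length = i) (hψ : QState.Clear i ψ) :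
    (Prog.measureReset q s).Samples O (R, v₀ • ψ + v₁ • QState.gateX i ψ)
      (Finsupp.single (Function.update R s (false :: R s), ψ) (‖v₀‖ ^ 2) +
        Finsupp.single (Function.update R s (true :: R s), ψ) (‖v₁‖ ^ 2)) 3 := by
  refine Samples.pair (t₀ := 3) (t₁ := 3) (a₀ := v₀) (a₁ := v₁) ?_ le_rfl le_rfl
  simp [Prog.measureReset, Prog.run, MState.start, Config.tick, Config.set, Config.apply, hi,
    hψ.proj_false, hψ.proj_true, hψ.proj_false_gateX, hψ.proj_true_gateX, QState.gateX_gateX,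
    Function.update_of_ne hqs]

theorem Prog.samples_measureReset_seq {O : List Bool → List Bool} {R : ℕ → List Bool} {ψ : QState}
    {q s i : ℕ} {v₀ v₁ : ℂ} (hqs : q ≠ s) (hi : (R q).length = i) (hψ : QState.Clear i ψ)
    {Q : Prog} {ν : Bool → MState →₀ ℝ} {B : ℕ}
    (hQ : ∀ z, Q.Samples O (Function.update R s (z :: R s), ψ) (ν z) B) :
    (Prog.seq (Prog.measureReset q s) Q).Samples O (R, v₀ • ψ + v₁ • QState.gateX i ψ)
      (‖v₀‖ ^ 2 • ν false + ‖v₁‖ ^ 2 • ν true) (3 + B) := by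
  classical
  have hne : ((Function.update R s (true :: R s), ψ) : MState) ≠
      (Function.update R s (false :: R s), ψ) := by
    intro h
    have := congrFun (congrArg Prod.fst h) s
    simp at this
  have := (Prog.samples_measureReset (O := O) (v₀ := v₀) (v₁ := v₁) hqs hi hψ).seq (Q := Q) (B' := B)
    (ν' := fun s' => if s' = (Function.update R s (false :: R s), ψ) then ν false else ν true)
    fun s' hs' => by
      rcases Finset.mem_union.1 (Finsupp.support_add hs') with h | h
      · rw [Finset.mem_singleton.1 (Finsupp.support_single_subset h), if_pos rfl]
        exact hQ false
      · rw [Finset.mem_singleton.1 (Finsupp.support_single_subset h), if_neg hne]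
        exact hQ true
  rwa [map_add, Finsupp.linearCombination_single, Finsupp.linearCombination_single, if_pos rfl,
    if_neg hne] at this

/-- The first `L` bits of a stream, the last one on top. -/
def revPrefix (t : ℕ → Bool) (L : ℕ) : List Bool := ((List.range L).map t).reverse

theorem revPrefix_succ (t : ℕ → Bool) (L : ℕ) : revPrefix t (L + 1) = t L :: revPrefix t L := by
  simp [revPrefix, List.range_succ]

@[simp] theorem length_revPrefix (t : ℕ → Bool) (L : ℕ) : (revPrefix t L).length = L := by
  simp [revPrefix]

theorem norm_codeAmp_sq (b t z : Bool) :
    ‖codeAmp b t z‖ ^ 2 = if b then 1 / 2 else if t = z then 1 else 0 := by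
  have := QState.norm_inv_sqrt_two_sq
  cases b <;> cases t <;> cases z <;> simp_all [codeAmp]

/-- Put the qubit addressed by stack `6` with its top removed in state `|0⟩`. -/
def Prog.resetOne : Prog :=
  .seq (.pop 6) (.seq (.measureReset 6 4) (.seq (.pop 4) (.pop 9)))

/-- The attack must start from `QState.zero`, so surplus qubits are measured and cleared. Their
outcomes are discarded, which makes the step deterministic. -/
theorem Prog.samples_resetLoop (O : List Bool → List Bool) (b t : ℕ → Bool) (w k : ℕ)
    (N K : List Bool) :
    (Prog.loop 9 Prog.resetOne).Samples O
      (stackFile [[], N, [], [], [], [], revPrefix t (w + k), [], [], unary k, K, []],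
        codeState (w + k) b t)
      (Finsupp.single
        (stackFile [[], N, [], [], [], [], revPrefix t w, [], [], [], K, []],
          codeState w b t) 1) (k * 6 + 1) := by
  refine Prog.Samples.loop_down (O := O) (Q := Prog.resetOne) (r := 9) (k := k) (B := 6)
    (fun k => (stackFile [[], N, [], [], [], [], revPrefix t (w + k), [], [], unary k, K, []],
        codeState (w + k) b t)) (by simp [stackFile, unary]) fun i _ => ?_
  have h := Prog.samples_measureReset_seq (O := O) (q := 6) (s := 4) (i := w + i)
    (R := stackFile [[], N, [], [], [], [], revPrefix t (w + i), [], [], unary (i + 1), K, []])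
    (ψ := codeState (w + i) b t) (v₀ := codeAmp (b (w + i)) (t (w + i)) false)
    (v₁ := codeAmp (b (w + i)) (t (w + i)) true) (by norm_num) (by simp [stackFile])
    (codeState_clear _ b t le_rfl) (Q := .seq (.pop 4) (.pop 9)) (B := 2)
    (ν := fun _ => Finsupp.single (stackFile
      [[], N, [], [], [], [], revPrefix t (w + i), [], [], unary i, K, []],
        codeState (w + i) b t) 1) fun z =>
      (Prog.Samples.pop 4).seq_single ((Prog.Samples.pop 9).of_eq (by
        simp [update_stackFile]; simp [stackFile, unary]))
  rw [← codeState_succ, ← add_smul, norm_codeAmp_sq, norm_codeAmp_sq] at h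
  refine (Prog.Samples.pop 6).seq_single (B := 1) (B' := 5) ?_
  have e : Function.update (stackFile
      [[], N, [], [], [], [], revPrefix t (w + (i + 1)), [], [], unary (i + 1), K, []]) 6
        (stackFile [[], N, [], [], [], [], revPrefix t (w + (i + 1)), [], [], unary (i + 1), K, []]
          6).tail =
      stackFile [[], N, [], [], [], [], revPrefix t (w + i), [], [], unary (i + 1), K, []] := by
    rw [update_stackFile (by simp), ← add_assoc, revPrefix_succ]
    rfl
  rw [e]
  -- Both outcomes lead to the same state, so only the total weight, which is 1, matters.
  have e1 : ((if b (w + i) then 1 / 2 else if t (w + i) = false then 1 else 0) +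
      if b (w + i) then 1 / 2 else if t (w + i) = true then (1 : ℝ) else 0) = 1 := by
    cases b (w + i) <;> cases t (w + i) <;> norm_num
  rw [e1, one_smul] at h
  exact h

/-! # Unambiguous discrimination of the two bases -/

/-- Record that an index is not conclusive. -/
def Prog.recordMiss : Prog := .seq (.push 3 false) (.push 11 false)

/-- Record that an index is conclusive, and the generated bit, unless enough indices have been
found. -/
def Prog.recordHit : Prog :=
  .cases 10 .recordMiss .recordMiss
    (.seq (.pop 10) (.seq (.push 3 true) (.seq (.push 11 true)
      (.cases 4 .skip (.push 2 true) (.push 2 false)))))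

/-- Compare the outcome on stack `5` with the tag bit on stack `7`. -/
def Prog.record : Prog :=
  .seq (.cases 7 .skip (.cases 5 .skip .recordMiss .recordHit)
    (.cases 5 .skip .recordHit .recordMiss)) (.seq (.pop 4) (.seq (.pop 5) (.pop 7)))

theorem Prog.samples_record_miss (O : List Bool → List Bool) (N V M T K M' : List Bool) (ψ : QState)
    (z t : Bool) :
    Prog.record.Samples O (stackFile [[], N, V, M, [z], [t], T, [t], [], [], K, M'], ψ)
      (Finsupp.single
        (stackFile [[], N, V, false :: M, [], [], T, [], [], [], K, false :: M'], ψ) 1) 11 := by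
  refine Samples.pure (a := 1) (t := 7) (by simp) ?_ (by norm_num)
  cases t <;> simp [Prog.record, Prog.recordMiss, Prog.run, MState.start, Config.tick, Config.set,
    update_stackFile, stackFile]

theorem Prog.samples_record_full (O : List Bool → List Bool) (N V M T M' : List Bool) (ψ : QState)
    (z t : Bool) :
    Prog.record.Samples O (stackFile [[], N, V, M, [z], [!t], T, [t], [], [], [], M'], ψ)
      (Finsupp.single
        (stackFile [[], N, V, false :: M, [], [], T, [], [], [], [], false :: M'], ψ) 1) 11 := by
  refine Samples.pure (a := 1) (t := 8) (by simp) ?_ (by norm_num)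
  cases t <;> simp [Prog.record, Prog.recordHit, Prog.recordMiss, Prog.run, MState.start,
    Config.tick, Config.set, update_stackFile, stackFile]

/-- The bit pushed on stack `2` is `!z`: an outcome that contradicts the tag bit excludes the
measured basis `z`. This is the longest path, and its 11 steps serve as common bound for the other
two. -/
theorem Prog.samples_record_hit (O : List Bool → List Bool) (N V M T K M' : List Bool) (ψ : QState)
    (z t : Bool) :
    Prog.record.Samples O (stackFile [[], N, V, M, [z], [!t], T, [t], [], [], true :: K, M'], ψ)
      (Finsupp.single
        (stackFile [[], N, (!z) :: V, true :: M, [], [], T, [], [], [], K, true :: M'], ψ) 1)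
      11 := by
  refine Samples.pure (a := 1) (t := 11) (by simp) ?_ (by norm_num)
  cases t <;> cases z <;> simp [Prog.record, Prog.recordHit, Prog.run, MState.start,
    Config.tick, Config.set, update_stackFile, stackFile]

/-- Amplitude of outcome `o` when the encoding of bit `t` in basis `b` is measured in basis `z`. -/
noncomputable def measureAmp (z b t o : Bool) : ℂ :=
  if z then (Real.sqrt 2 : ℂ)⁻¹ * (codeAmp b t false + (if o then -1 else 1) * codeAmp b t true)
  else codeAmp b t o

/-- The two bases are mutually unbiased: the right basis returns the encoded bit with certainty, the
wrong one a fair coin. The whole attack rests on this. -/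
theorem norm_measureAmp_sq (z b t o : Bool) :
    ‖measureAmp z b t o‖ ^ 2 = if z = b then (if o = t then 1 else 0) else 1 / 2 := by
  have h := QState.norm_inv_sqrt_two_sq
  have h2 : (Real.sqrt 2 : ℂ)⁻¹ * ((Real.sqrt 2 : ℂ)⁻¹ + (Real.sqrt 2 : ℂ)⁻¹) = 1 := by
    rw [← two_mul, ← mul_assoc, mul_comm _ (2 : ℂ), mul_assoc, ← mul_inv, ← Complex.ofReal_mul,
      Real.mul_self_sqrt (by norm_num)]
    norm_num
  cases z
  · rw [measureAmp, if_neg (by simp), norm_codeAmp_sq]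
    cases b <;> cases t <;> cases o <;> simp
  · cases b <;> cases t <;> cases o <;> simp_all [measureAmp, codeAmp, ← sub_eq_add_neg]

/-- Measure the topmost of the qubits addressed by stack `6` in a random basis, compare the outcome
with the tag bit on top of stack `6`, and remove the latter. -/
def Prog.pickOne : Prog :=
  .seq (.gateH 6) (.seq (.measureReset 6 4) (.seq (.moveOne 6 7)
    (.seq (.cases 4 .skip .skip (.gateH 6)) (.seq (.measureReset 6 5) .record))))

/-- Stacks when the indices from `i` on have been processed, with `I` the conclusive ones. -/
def pickFile (b t : ℕ → Bool) (N : List Bool) (p w i : ℕ) (I : Finset ℕ) : ℕ → List Bool :=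
  stackFile [[], N, ((List.range' i (w - i)).filter fun j => decide (j ∈ I)).map b,
    (List.range' i (w - i)).map fun j => decide (j ∈ I), [], [], revPrefix t i, [], [], [],
    unary (p - I.card), (List.range' i (w - i)).map fun j => decide (j ∈ I)]

theorem Prog.samples_pickOne_measure (O : List Bool → List Bool) (b t : ℕ → Bool)
    (i : ℕ) (N V M T K M' : List Bool) (hT : T.length = i) (z : Bool)
    {s₀ s₁ : MState}
    (h₁ : Prog.record.Samples O (stackFile [[], N, V, M, [z], [t i], T, [t i], [], [], K, M'],
      codeState i b t) (Finsupp.single s₀ 1) 11)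
    (h₂ : Prog.record.Samples O (stackFile [[], N, V, M, [z], [!t i], T, [t i], [], [], K, M'],
      codeState i b t) (Finsupp.single s₁ 1) 11) :
    (Prog.seq (.moveOne 6 7) (.seq (.cases 4 .skip .skip (.gateH 6))
      (.seq (.measureReset 6 5) .record))).Samples O
      (stackFile [[], N, V, M, [z], [], t i :: T, [], [], [], K, M'], codeState (i + 1) b t)
      (if z = b i then Finsupp.single s₀ 1 else
        (1 / 2 : ℝ) • Finsupp.single s₀ 1 + (1 / 2 : ℝ) • Finsupp.single s₁ 1) 19 := by
  have hc := codeState_clear i b t le_rfl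
  refine Prog.Samples.seq_single (B := 3) (B' := 16)
    ((Prog.samples_moveOne (by norm_num) (b := t i) (l := T) (by simp [stackFile])).of_eq
      (s'' := (stackFile [[], N, V, M, [z], [], T, [t i], [], [], K, M'], codeState (i + 1) b t))
      (by simp [update_stackFile, stackFile])) ?_
  refine Prog.Samples.seq_single (B := 2) (B' := 14)
    (s' := (stackFile [[], N, V, M, [z], [], T, [t i], [], [], K, M'],
      measureAmp z (b i) (t i) false • codeState i b t +
        measureAmp z (b i) (t i) true • QState.gateX i (codeState i b t))) ?_ ?_
  · rw [codeState_succ]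
    cases z
    · exact Prog.Samples.cases_false (l := []) (by simp [stackFile]) Prog.Samples.skip
    · refine Prog.Samples.cases_true (l := []) (by simp [stackFile])
        ((Prog.Samples.gateH 6).of_eq ?_)
      have e : (stackFile [[], N, V, M, [true], [], T, [t i], [], [], K, M'] 6).length = i := by
        simpa [stackFile] using hT
      rw [e, map_add, map_smul, map_smul, hc.gateH, hc.gateH_gateX]
      simp only [measureAmp, if_true, Bool.false_eq_true, if_false, Prod.mk.injEq, true_and]
      module
  · have key := Prog.samples_measureReset_seq (O := O) (q := 6) (s := 5) (i := i)
      (R := stackFile [[], N, V, M, [z], [], T, [t i], [], [], K, M'])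
      (ψ := codeState i b t) (v₀ := measureAmp z (b i) (t i) false)
      (v₁ := measureAmp z (b i) (t i) true) (by norm_num) (by simpa [stackFile] using hT) hc
      (Q := .record) (B := 11)
      (ν := fun o => if o = t i then Finsupp.single s₀ 1 else Finsupp.single s₁ 1) (fun o => by
        rw [update_stackFile (by simp)]
        by_cases ho : o = t i
        · subst ho
          simpa [stackFile] using h₁
        · have : o = !t i := by revert ho; cases o <;> cases t i <;> simp
          subst this
          simpa [stackFile] using h₂)
    rw [norm_measureAmp_sq, norm_measureAmp_sq] at key
    convert key using 1
    cases z <;> cases b i <;> cases t i <;> simp [add_comm]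

/-- The wrong basis is drawn with probability 1/2 and then betrays itself with probability 1/2. Once
`p` indices are known, a further hit is recorded like a miss. -/
theorem Prog.samples_pickOne (O : List Bool → List Bool) (b t : ℕ → Bool) (N : List Bool)
    {p w i : ℕ} (hi : i < w) {I : Finset ℕ} (hI : ∀ j ∈ I, i + 1 ≤ j) :
    Prog.pickOne.Samples O (pickFile b t N p w (i + 1) I, codeState (i + 1) b t)
      ((1 / 4 : ℝ) • Finsupp.single (pickFile b t N p w i (if I.card < p then insert i I else I),
          codeState i b t) 1 +
        (3 / 4 : ℝ) • Finsupp.single (pickFile b t N p w i I, codeState i b t) 1) 23 := by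
  have hiI : i ∉ I := fun h => by have := hI i h; omega
  have hr : List.range' i (w - i) = i :: List.range' (i + 1) (w - (i + 1)) := by
    rw [← List.range'_succ]; congr 1; omega
  set V := ((List.range' (i + 1) (w - (i + 1))).filter fun j => decide (j ∈ I)).map b with hV
  set M := (List.range' (i + 1) (w - (i + 1))).map fun j => decide (j ∈ I) with hM
  have e0 : pickFile b t N p w (i + 1) I = stackFile
      [[], N, V, M, [], [], t i :: revPrefix t i, [], [], [], unary (p - I.card), M] := by
    rw [pickFile, revPrefix_succ]
  have e1 : pickFile b t N p w i I = stackFile [[], N, V, false :: M, [], [], revPrefix t i, [], [],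
      [], unary (p - I.card), false :: M] := by
    rw [pickFile, hr]; simp [hiI, hV, hM]
  have e2 : pickFile b t N p w i (insert i I) = stackFile [[], N, b i :: V, true :: M, [], [],
      revPrefix t i, [], [], [], unary (p - (I.card + 1)), true :: M] := by
    have hne : ∀ j ∈ List.range' (i + 1) (w - (i + 1)),
        decide (j ∈ insert i I) = decide (j ∈ I) := fun j hj => by
      have : j ≠ i := by have := (List.mem_range'_1.1 hj).1; omega
      simp [this]
    rw [pickFile, hr, List.filter_cons_of_pos (by simp), List.map_cons, List.map_cons,
      List.filter_congr hne, List.map_congr_left hne, Finset.card_insert_of_notMem hiI]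
    simp [hV, hM]
  have hc := codeState_clear (i + 1) b t le_rfl
  set F := (if I.card < p then insert i I else I) with hF
  have hmeas : ∀ z, (Prog.seq (.moveOne 6 7) (.seq (.cases 4 .skip .skip (.gateH 6))
      (.seq (.measureReset 6 5) .record))).Samples O
      (stackFile [[], N, V, M, [z], [], t i :: revPrefix t i, [], [], [], unary (p - I.card), M],
        codeState (i + 1) b t)
      (if z = b i then Finsupp.single (pickFile b t N p w i I, codeState i b t) 1 else
        (1 / 2 : ℝ) • Finsupp.single (pickFile b t N p w i I, codeState i b t) 1 +
        (1 / 2 : ℝ) • Finsupp.single (pickFile b t N p w i F, codeState i b t) 1) 19 := by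
    intro z
    have h1 := Prog.samples_record_miss O N V M (revPrefix t i) (unary (p - I.card)) M
      (codeState i b t) z (t i)
    rw [← e1] at h1
    by_cases hz : z = b i
    -- In the right basis a contradicting outcome has weight 0, so it is irrelevant which state
    -- `record` would produce.
    · obtain ⟨s₁, h2⟩ : ∃ s₁, Prog.record.Samples O (stackFile [[], N, V, M, [z], [!t i],
          revPrefix t i, [t i], [], [], unary (p - I.card), M], codeState i b t)
          (Finsupp.single s₁ 1) 11 := by
        rcases h : unary (p - I.card) with - | ⟨a, K⟩
        · exact ⟨_, Prog.samples_record_full ..⟩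
        · have ha : a = true := by
            have : a ∈ unary (p - I.card) := by rw [h]; simp
            exact (List.mem_replicate.1 this).2
          subst ha
          exact ⟨_, Prog.samples_record_hit ..⟩
      have := Prog.samples_pickOne_measure O b t i N V M _ _ M (length_revPrefix t i) z h1 h2
      rw [if_pos hz] at this ⊢
      exact this
    · refine Prog.samples_pickOne_measure O b t i N V M _ _ M (length_revPrefix t i) z h1 ?_
      by_cases hp : I.card < p
      · have hb : b i = !z := by revert hz; cases z <;> cases b i <;> simp
        rw [hF, if_pos hp, e2, hb]
        have : unary (p - I.card) = true :: unary (p - (I.card + 1)) := by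
          rw [unary, unary, ← List.replicate_succ]; congr 1; omega
        rw [this]
        exact Prog.samples_record_hit ..
      · rw [hF, if_neg hp, e1]
        have : unary (p - I.card) = [] := by
          rw [unary, Nat.sub_eq_zero_of_le (by omega)]; rfl
        rw [this]
        exact Prog.samples_record_full ..
  -- While the tag bit is still on stack `6`, its length `i + 1` addresses the first clear qubit,
  -- which serves as the coin. Removing the tag bit makes the same stack address qubit `i`.
  have key := Prog.samples_measureReset_seq (O := O) (q := 6) (s := 4) (i := i + 1)
    (R := pickFile b t N p w (i + 1) I) (ψ := codeState (i + 1) b t)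
    (v₀ := (Real.sqrt 2 : ℂ)⁻¹) (v₁ := (Real.sqrt 2 : ℂ)⁻¹) (by norm_num)
    (by simp [pickFile, stackFile]) hc (B := 19) (fun z => by
      have := hmeas z
      rw [e0, update_stackFile (by simp)]
      exact this)
  refine ((Prog.Samples.gateH 6).of_eq (s'' := (pickFile b t N p w (i + 1) I,
    (Real.sqrt 2 : ℂ)⁻¹ • codeState (i + 1) b t +
      (Real.sqrt 2 : ℂ)⁻¹ • QState.gateX (i + 1) (codeState (i + 1) b t))) ?_).seq_single
      (B := 1) (B' := 22) ?_
  · have : (pickFile b t N p w (i + 1) I 6).length = i + 1 := by simp [pickFile, stackFile]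
    rw [this, hc.gateH, smul_add]
  · convert key using 1
    rw [QState.norm_inv_sqrt_two_sq]
    cases b i
    · simp only [if_true, Bool.true_eq_false, if_false]
      module
    · simp only [if_true, Bool.false_eq_true, if_false]
      module

/-- The hypothesis `heq` is needed because the two successors coincide once enough indices have been
found. -/
theorem Prog.Samples.iter_succ_pair {O : List Bool → List Bool} {Q : Prog} {s s₀ s₁ : MState}
    {ν₀ ν₁ : MState →₀ ℝ} {x y : ℝ} {B B' k : ℕ}
    (h : Q.Samples O s (x • Finsupp.single s₀ 1 + y • Finsupp.single s₁ 1) B)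
    (h₀ : _root_.Samples (Q.iter O k) s₀ ν₀ B') (h₁ : _root_.Samples (Q.iter O k) s₁ ν₁ B')
    (heq : s₀ = s₁ → ν₀ = ν₁) :
    _root_.Samples (Q.iter O (k + 1)) s (x • ν₀ + y • ν₁) (B + B') := by
  classical
  set ν' : MState → MState →₀ ℝ := fun s' => if s' = s₀ then ν₀ else ν₁
  have e₀ : ν' s₀ = ν₀ := if_pos rfl
  have e₁ : ν' s₁ = ν₁ := by
    by_cases he : s₁ = s₀
    · simp only [ν', if_pos he, heq he.symm]
    · simp only [ν', if_neg he]
  have := Prog.Samples.iter_succ (k := k) (ν' := ν') (B' := B') h fun s' hs' => by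
    rcases Finset.mem_union.1 (Finsupp.support_add hs') with h | h <;>
      rw [Finset.mem_singleton.1 (Finsupp.support_single_subset (Finsupp.support_smul h))]
    · rwa [e₀]
    · rwa [e₁]
  rwa [map_add, map_smul, map_smul, Finsupp.linearCombination_single,
    Finsupp.linearCombination_single, one_smul, one_smul, e₀, e₁] at this

theorem Prog.samples_pickLoop (O : List Bool → List Bool) (b t : ℕ → Bool) (N : List Bool)
    (p w : ℕ) :
    (Prog.loop 6 Prog.pickOne).Samples O (pickFile b t N p w w ∅, codeState w b t)
      (Finsupp.linearCombination ℝ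
        (fun J => Finsupp.single (pickFile b t N p w 0 J, QState.zero) (1 : ℝ))
        (pickDist p w ∅)) (w * 23 + 1) := by
  refine Prog.Samples.loop (k := w) (by simp [pickFile, stackFile]) ?_
  suffices h : ∀ i ≤ w, ∀ I : Finset ℕ, (∀ j ∈ I, i ≤ j) →
      _root_.Samples (Prog.pickOne.iter O i) (pickFile b t N p w i I, codeState i b t)
      (Finsupp.linearCombination ℝ
        (fun J => Finsupp.single (pickFile b t N p w 0 J, QState.zero) (1 : ℝ))
        (pickDist p i I)) (i * 23) from h w le_rfl ∅ (by simp)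
  intro i
  induction i with
  | zero =>
    intro _ I _
    simpa [pickDist] using Prog.Samples.iter_zero
  | succ i ih =>
    intro hi I hI
    rw [pickDist, map_add, map_smul, map_smul, Nat.succ_mul, Nat.add_comm (i * 23)]
    refine Prog.Samples.iter_succ_pair (Prog.samples_pickOne O b t N hi hI)
      (ih (by omega) _ fun j hj => ?_) (ih (by omega) I fun j hj => ?_) fun he => ?_
    · split_ifs at hj
      · rcases Finset.mem_insert.1 hj with rfl | hj
        · exact le_rfl
        · have := hI j hj; omega
      · have := hI j hj; omega
    · have := hI j hj; omega
    · congr 2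
      split_ifs at he ⊢ with hp
      -- As long as the set is not complete, hit and miss differ in the mask bit of index `i`, so
      -- the successors cannot be equal.
      · have h3 := congrFun (congrArg Prod.fst he) 3
        simp only [pickFile, stackFile, List.getD_cons_succ, List.getD_cons_zero] at h3
        have := List.map_inj_left.1 h3 i (List.mem_range'_1.2 ⟨le_rfl, by omega⟩)
        simp only [Finset.mem_insert_self, decide_true] at this
        exact absurd (hI i (of_decide_eq_true this.symm)) (by omega)
      · rfl

/-! # The adversary -/

/-- Ask the oracle for the tag of the next message. -/
def Prog.fetchTag : Prog :=
  .seq (.loop 2 (.moveOne 5 7)) (.seq (.loop 7 (.moveOne 7 8)) (.seq (.oracle 8 9)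
    (.seq (.clear 8) (.loop 9 (.moveOne 9 6)))))

theorem HashScheme.hashOracle_ofFn (S : HashScheme) (n : ℕ) (h : S.Msg n → Fin (S.tagCard n))
    (y : S.Msg n) :
    S.hashOracle n h (List.ofFn y) = (List.range (S.tagLen n)).map (Nat.testBit (h y)) := by
  have : (fun i : Fin (S.msgLen n) => (List.ofFn y).getD i false) = y := by
    funext i; simp [List.getD_eq_getElem?_getD]
  rw [HashScheme.hashOracle, this]

theorem HashScheme.revPrefix_tagStream (S : HashScheme) (n : ℕ)
    (h : S.Msg n → Fin (S.tagCard n)) (Y : ℕ → S.Msg n) (j : ℕ) :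
    ((List.range (S.tagLen n)).map (Nat.testBit (h (Y j)))).reverse ++
      revPrefix (S.tagStream n h Y) (j * S.tagLen n) =
      revPrefix (S.tagStream n h Y) ((j + 1) * S.tagLen n) := by
  rw [revPrefix, revPrefix, ← List.reverse_append, Nat.succ_mul, List.range_add, List.map_append,
    List.map_map]
  congr 2
  refine List.map_congr_left fun r hr => ?_
  have hr := List.mem_range.1 hr
  have h0 : 0 < S.tagLen n := by omega
  rw [Function.comp_apply, HashScheme.tagStream, mul_comm, Nat.mul_add_div h0,
    Nat.div_eq_of_lt hr, Nat.mul_add_mod, Nat.mod_eq_of_lt hr, add_zero]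

/-- The messages from number `j` on, one after the other. -/
def messagesFrom {l : ℕ} (Y : ℕ → Fin l → Bool) (N j : ℕ) : List Bool :=
  ((List.range' j (N - j)).map fun j => List.ofFn (Y j)).flatten

theorem messagesFrom_of_lt {l : ℕ} (Y : ℕ → Fin l → Bool) {N j : ℕ} (hj : j < N) :
    messagesFrom Y N j = List.ofFn (Y j) ++ messagesFrom Y N (j + 1) := by
  have : N - j = N - (j + 1) + 1 := by omega
  rw [messagesFrom, this, List.range'_succ]
  simp [messagesFrom]

/-- The message is moved twice, the second move undoing the reversal, so that the query is in the
right order. The answer is moved once: its reversal on stack `6` puts the last tag bit on top. -/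
theorem Prog.samples_fetchTag (S : HashScheme) (n : ℕ) (h : S.Msg n → Fin (S.tagCard n))
    (Y : ℕ → S.Msg n) {N j : ℕ} (hj : j < N) (a b c : List Bool) (ψ : QState) :
    Prog.fetchTag.Samples (S.hashOracle n h)
      (stackFile [[], a, unary (S.msgLen n), b, c, messagesFrom Y N j,
        revPrefix (S.tagStream n h Y) (j * S.tagLen n), [], [], [], [], []], ψ)
      (Finsupp.single (stackFile [[], a, unary (S.msgLen n), b, c, messagesFrom Y N (j + 1),
        revPrefix (S.tagStream n h Y) ((j + 1) * S.tagLen n), [], [], [], [], []], ψ) 1)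
      (8 * S.msgLen n + 4 * S.tagLen n + 5) := by
  set O := S.hashOracle n h
  set l := S.msgLen n
  set k := S.tagLen n
  set T := revPrefix (S.tagStream n h Y) (j * k)
  set M := messagesFrom Y N (j + 1)
  set y := List.ofFn (Y j) with hy
  have hyl : y.length = l := by rw [hy, List.length_ofFn]
  have hO : O y = (List.range k).map (Nat.testBit (h (Y j))) := S.hashOracle_ofFn n h (Y j)
  rw [messagesFrom_of_lt Y hj, ← S.revPrefix_tagStream]
  have s1 := (Prog.samples_move (O := O) (ψ := ψ) (r := 5) (s := 7) (a := 2) (k := l)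
    (R := stackFile [[], a, unary l, b, c, y ++ M, T, [], [], [], [], []])
    (by norm_num) (by simp [stackFile, unary]) (by simp [stackFile, hyl])).of_eq
    (s'' := (stackFile [[], a, unary l, b, c, M, T, y.reverse, [], [], [], []], ψ))
    (by simp [update_stackFile, stackFile, ← hyl])
  have s2 := (Prog.samples_move (O := O) (ψ := ψ) (r := 7) (s := 8) (a := 7) (k := l)
    (R := stackFile [[], a, unary l, b, c, M, T, y.reverse, [], [], [], []])
    (by norm_num) (by simp [stackFile, hyl]) (by simp [stackFile, hyl])).of_eq
    (s'' := (stackFile [[], a, unary l, b, c, M, T, [], y, [], [], []], ψ))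
    (by simp [update_stackFile, stackFile, hyl, List.take_of_length_le, List.drop_eq_nil_of_le])
  have s3 := ((Prog.Samples.oracle (O := O) (ψ := ψ)
    (R := stackFile [[], a, unary l, b, c, M, T, [], y, [], [], []]) 8 9).of_eq
    (s'' := (stackFile [[], a, unary l, b, c, M, T, [], y, O y, [], []], ψ))
    (by simp [update_stackFile, stackFile])).mono (B' := 1 + l + k)
    (by simp [stackFile, hyl, hO])
  have s4 := ((Prog.samples_clear (O := O) (ψ := ψ)
    (R := stackFile [[], a, unary l, b, c, M, T, [], y, O y, [], []]) (r := 8)).of_eq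
    (s'' := (stackFile [[], a, unary l, b, c, M, T, [], [], O y, [], []], ψ))
    (by simp [update_stackFile])).mono (B' := l + 1)
    (by simp [stackFile, hyl])
  have s5 := (Prog.samples_move (O := O) (ψ := ψ) (r := 9) (s := 6) (a := 9) (k := k)
    (R := stackFile [[], a, unary l, b, c, M, T, [], [], O y, [], []])
    (by norm_num) (by simp [stackFile, hO]) (by simp [stackFile, hO])).of_eq
    (s'' := (stackFile [[], a, unary l, b, c, M,
      ((List.range k).map (Nat.testBit (h (Y j)))).reverse ++ T, [], [], [], [], []], ψ))
    (by simp [update_stackFile, stackFile, hO, List.take_of_length_le, List.drop_eq_nil_of_le])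
  exact (s1.seq_single (s2.seq_single (s3.seq_single (s4.seq_single s5)))).mono (by omega)

/-- Set up the stacks: tags on stack `6`, their number beyond `8 * p n` on stack `9`, and `p n` on
stack `10`; `A` and `B` compute `8 * p n` and `p n`. -/
def Prog.prepare (A B : Prog) : Prog :=
  .seq (.loop 4 .fetchTag) (.seq (.clear 2) (.seq (.clear 3) (.seq (.clear 4) (.seq A (.seq B
    (.seq (.loop 6 (.push 9 true)) (.loop 8 (.seq (.pop 9) (.pop 8)))))))))

theorem Prog.samples_prepare (S : HashScheme) (n : ℕ) (h : S.Msg n → Fin (S.tagCard n))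
    (Y : ℕ → S.Msg n) (N p : ℕ) (ψ : QState) {A B : Prog} {tA tB : ℕ}
    (hp : 8 * p ≤ N * S.tagLen n)
    (hA : ∀ O R ψ, (R 1).length = n → A.Samples O (R, ψ)
      (Finsupp.single (Function.update R 8 (unary (8 * p) ++ R 8), ψ) 1) tA)
    (hB : ∀ O R ψ, (R 1).length = n → B.Samples O (R, ψ)
      (Finsupp.single (Function.update R 10 (unary p ++ R 10), ψ) 1) tB) :
    (Prog.prepare A B).Samples (S.hashOracle n h)
      (stackFile [[], unary n, unary (S.msgLen n), unary (S.tagLen n), unary N,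
        messagesFrom Y N 0, [], [], [], [], [], []], ψ)
      (Finsupp.single (stackFile [[], unary n, [], [], [], [],
        revPrefix (S.tagStream n h Y) (N * S.tagLen n), [], [],
        unary (N * S.tagLen n - 8 * p), unary p, []], ψ) 1)
      (N * (8 * S.msgLen n + 4 * S.tagLen n + 5) + S.msgLen n + S.tagLen n + N + tA + tB +
        3 * (N * S.tagLen n) + 6) := by
  set O := S.hashOracle n h
  set l := S.msgLen n
  set k := S.tagLen n
  set T := revPrefix (S.tagStream n h Y) (N * k) with hT
  have s1 := (Prog.Samples.loop_up (O := O) (Q := .fetchTag) (r := 4) (k := N)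
    (B := 8 * l + 4 * k + 5) (fun j => (stackFile [[], unary n, unary l, unary k, unary N,
      messagesFrom Y N j, revPrefix (S.tagStream n h Y) (j * k), [], [], [], [], []], ψ))
    (by simp [stackFile, unary]) fun j hj => Prog.samples_fetchTag S n h Y hj ..).of_eq
    (s'' := (stackFile [[], unary n, unary l, unary k, unary N, [], T, [], [], [], [], []], ψ))
    (by simp [hT, messagesFrom])
  simp only [zero_mul, revPrefix, List.range_zero, List.map_nil, List.reverse_nil] at s1
  have s2 := ((Prog.samples_clear (O := O) (ψ := ψ) (r := 2)
    (R := stackFile [[], unary n, unary l, unary k, unary N, [], T, [], [], [], [], []])).of_eq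
    (s'' := (stackFile [[], unary n, [], unary k, unary N, [], T, [], [], [], [], []], ψ))
    (by simp [update_stackFile])).mono (B' := l + 1) (by simp [stackFile, unary])
  have s3 := ((Prog.samples_clear (O := O) (ψ := ψ) (r := 3)
    (R := stackFile [[], unary n, [], unary k, unary N, [], T, [], [], [], [], []])).of_eq
    (s'' := (stackFile [[], unary n, [], [], unary N, [], T, [], [], [], [], []], ψ))
    (by simp [update_stackFile])).mono (B' := k + 1) (by simp [stackFile, unary])
  have s4 := ((Prog.samples_clear (O := O) (ψ := ψ) (r := 4)
    (R := stackFile [[], unary n, [], [], unary N, [], T, [], [], [], [], []])).of_eq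
    (s'' := (stackFile [[], unary n, [], [], [], [], T, [], [], [], [], []], ψ))
    (by simp [update_stackFile])).mono (B' := N + 1) (by simp [stackFile, unary])
  have s5 := (hA O (stackFile [[], unary n, [], [], [], [], T, [], [], [], [], []]) ψ
    (by simp [stackFile, unary])).of_eq
    (s'' := (stackFile [[], unary n, [], [], [], [], T, [], unary (8 * p), [], [], []], ψ))
    (by simp [update_stackFile, stackFile])
  have s6 := (hB O (stackFile [[], unary n, [], [], [], [], T, [], unary (8 * p), [], [], []]) ψ
    (by simp [stackFile, unary])).of_eq
    (s'' := (stackFile [[], unary n, [], [], [], [], T, [], unary (8 * p), [], unary p, []], ψ))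
    (by simp [update_stackFile, stackFile])
  have s7 := Prog.Samples.loop_up (O := O) (Q := .push 9 true) (r := 6) (k := N * k) (B := 1)
    (fun j => (stackFile [[], unary n, [], [], [], [], T, [], unary (8 * p), unary j, unary p, []],
      ψ)) (by simp [stackFile, hT]) fun j _ => (Prog.Samples.push 9 true).of_eq
        (by simp [update_stackFile, stackFile, unary, List.replicate_succ])
  -- Unary subtraction. The length of stack `9` is written as surplus plus what is still to be
  -- removed; `hp` identifies it at the start with `N * k`.
  have s8 := Prog.Samples.loop_down (O := O) (Q := .seq (.pop 9) (.pop 8)) (r := 8) (k := 8 * p)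
    (B := 2) (fun j => (stackFile [[], unary n, [], [], [], [], T, [], unary j,
      unary (N * k - 8 * p + j), unary p, []], ψ)) (by simp [stackFile, unary]) fun j _ =>
      (Prog.Samples.pop 9).seq_single ((Prog.Samples.pop 8).of_eq
        (by simp [update_stackFile, stackFile, unary]))
  rw [Nat.sub_add_cancel hp] at s8
  refine (s1.seq_single (s2.seq_single (s3.seq_single (s4.seq_single (s5.seq_single
    (s6.seq_single (s7.seq_single s8))))))).mono ?_
  change N * (8 * l + 4 * k + 5) + 1 + _ ≤ N * (8 * l + 4 * k + 5) + l + k + N + tA + tB + _ + 6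
  omega

/-- Determine the basis of `p n` of the first `8 * p n` qubits; keep the set of these on stack `m`. -/
def Prog.findBases (A B : Prog) (m : ℕ) : Prog :=
  .seq (.prepare A B) (.seq (.loop 9 .resetOne) (.seq (.loop 6 .pickOne)
    (.loop 11 (.moveOne 11 m))))

/-- Stacks after `Prog.findBases`, with `J` the conclusive indices found. -/
def basesFile (G : Generator) (n : ℕ) (x : Fin n → Bool) (p m : ℕ) (J : Finset ℕ) :
    ℕ → List Bool :=
  Function.update (stackFile [[], unary n,
    ((List.range (8 * p)).filter fun j => decide (j ∈ J)).map (G n x), bitMask (8 * p) J,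
    [], [], [], [], [], [], unary (p - J.card), []]) m (bitMask (8 * p) J).reverse

/-- Indices are processed downwards, so the pushed bits and mask end up in increasing order: stacks
`1`, `2`, `3` then hold exactly the input of the attack, and all qubits are clear. -/
theorem Prog.samples_findBases (G : Generator) (S : HashScheme) (n : ℕ)
    (h : S.Msg n → Fin (S.tagCard n)) (Y : ℕ → S.Msg n) (N p : ℕ) (x : Fin n → Bool) {A B : Prog}
    {tA tB m : ℕ} (hp : 8 * p ≤ N * S.tagLen n) (hm : 12 ≤ m)
    (hA : ∀ O R ψ, (R 1).length = n → A.Samples O (R, ψ)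
      (Finsupp.single (Function.update R 8 (unary (8 * p) ++ R 8), ψ) 1) tA)
    (hB : ∀ O R ψ, (R 1).length = n → B.Samples O (R, ψ)
      (Finsupp.single (Function.update R 10 (unary p ++ R 10), ψ) 1) tB) :
    (Prog.findBases A B m).Samples (S.hashOracle n h)
      (stackFile [[], unary n, unary (S.msgLen n), unary (S.tagLen n), unary N,
        messagesFrom Y N 0, [], [], [], [], [], []],
        codeState (N * S.tagLen n) (G n x) (S.tagStream n h Y))
      (Finsupp.linearCombination ℝ
        (fun J => Finsupp.single (basesFile G n x p m J, QState.zero) (1 : ℝ))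
        (pickDist p (8 * p) ∅))
      (N * (8 * S.msgLen n + 4 * S.tagLen n + 5) + S.msgLen n + S.tagLen n + N + tA + tB +
        40 * (N * S.tagLen n) + 9) := by
  classical
  set O := S.hashOracle n h
  have s1 := Prog.samples_prepare S n h Y N p
    (codeState (N * S.tagLen n) (G n x) (S.tagStream n h Y)) hp hA hB
  have s2 := Prog.samples_resetLoop O (G n x) (S.tagStream n h Y) (8 * p) (N * S.tagLen n - 8 * p)
    (unary n) (unary p)
  rw [Nat.add_sub_cancel' hp] at s2
  have s3 := Prog.samples_pickLoop O (G n x) (S.tagStream n h Y) (unary n) p (8 * p)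
  have e : pickFile (G n x) (S.tagStream n h Y) (unary n) p (8 * p) (8 * p) ∅ = stackFile
      [[], unary n, [], [], [], [], revPrefix (S.tagStream n h Y) (8 * p), [], [], [], unary p, []]
      := by simp [pickFile]
  rw [e] at s3
  set ν : MState → MState →₀ ℝ := fun s =>
    Finsupp.single (Function.update (Function.update s.1 m ((s.1 11).reverse ++ s.1 m)) 11 [], s.2) 1
    with hν
  have s4 : ∀ J, ν (pickFile (G n x) (S.tagStream n h Y) (unary n) p (8 * p) 0 J, QState.zero) =
      Finsupp.single (basesFile G n x p m J, QState.zero) (1 : ℝ) := fun J => by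
    have h0 : pickFile (G n x) (S.tagStream n h Y) (unary n) p (8 * p) 0 J m = [] := by
      rw [pickFile, stackFile, List.getD_eq_default]
      simpa using hm
    have h11 : pickFile (G n x) (S.tagStream n h Y) (unary n) p (8 * p) 0 J 11 =
        bitMask (8 * p) J := by
      simp [pickFile, stackFile, bitMask, List.range_eq_range']
    simp only [hν, h0, h11]
    rw [Function.update_comm (by omega), basesFile, pickFile, update_stackFile (by simp),
      List.append_nil]
    simp [bitMask, List.range_eq_range', revPrefix]
  have s5 := s3.seq (Q := .loop 11 (.moveOne 11 m)) (ν' := ν) (B' := 8 * p * 3 + 1)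
    fun s' hs' => by
      rw [Finsupp.linearCombination_apply] at hs'
      obtain ⟨J, -, hJ⟩ := Finset.mem_biUnion.1 (Finsupp.support_sum hs')
      rw [Finset.mem_singleton.1 (Finsupp.support_single_subset (Finsupp.support_smul hJ))]
      have hl : (pickFile (G n x) (S.tagStream n h Y) (unary n) p (8 * p) 0 J 11).length =
          8 * p := by simp [pickFile, stackFile]
      have := Prog.samples_move (O := O) (ψ := QState.zero)
        (R := pickFile (G n x) (S.tagStream n h Y) (unary n) p (8 * p) 0 J)
        (r := 11) (s := m) (a := 11) (k := 8 * p) (by omega) hl hl.ge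
      rwa [List.take_of_length_le hl.le, List.drop_eq_nil_of_le hl.le] at this
  rw [Finsupp.apply_linearCombination] at s5
  have e5 : ⇑(Finsupp.linearCombination ℝ ν) ∘ (fun J => Finsupp.single
      (pickFile (G n x) (S.tagStream n h Y) (unary n) p (8 * p) 0 J, QState.zero) (1 : ℝ)) =
      fun J => Finsupp.single (basesFile G n x p m J, QState.zero) (1 : ℝ) := by
    funext J
    rw [Function.comp_apply, Finsupp.linearCombination_single, one_smul, s4]
  rw [e5] at s5
  exact (s1.seq_single (s2.seq_single s5)).mono (by omega)

/-! # Running the attack on the bits found -/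

theorem quadratic_outDist_run (O : List Bool → List Bool) (P : Prog) :
    Quadratic fun c => outDist (P.run O c) := fun a t c => by
  simp only [P.run_scale]
  exact outDist_map_modify _ rfl a t _

theorem Prog.haltsWithin_run_of_time {O : List Bool → List Bool} {P : Prog} {s : MState} {B : ℕ}
    (h : HaltsWithin (P.run O s.start) B) {c : Config} {a : ℂ} (h1 : c.reg = s.1)
    (h2 : c.psi = a • s.2) : HaltsWithin (P.run O c) (B + c.time) := by
  rw [Config.eq_scale_start h1 h2, P.run_scale]
  intro d hd hd0
  obtain ⟨e, he, rfl⟩ := List.mem_map.1 hd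
  exact Nat.add_le_add (h e he fun h0 => hd0 (by simp [Config.modify, h0]))
    (by simp [Config.scale_eq])

theorem Prog.Samples.haltsWithin {O : List Bool → List Bool} {P : Prog} {s : MState}
    {ν : MState →₀ ℝ} {B : ℕ} (h : P.Samples O s ν B) : HaltsWithin (P.run O s.start) B :=
  fun c hc h0 => (h.bound c hc h0).1

/-- For the given attack only a time bound from its initial state is available. This suffices, since
every nonzero branch is a multiple of a state in the support. -/
theorem Prog.Samples.haltsWithin_seq {O : List Bool → List Bool} {P Q : Prog} {s : MState}
    {ν : MState →₀ ℝ} {B B' : ℕ} (h : P.Samples O s ν B)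
    (h' : ∀ s' ∈ ν.support, HaltsWithin (Q.run O s'.start) B') :
    HaltsWithin ((Prog.seq P Q).run O s.start) (B + B') := by
  intro d hd hd0
  obtain ⟨c, hc, hdc⟩ := List.mem_flatMap.1 hd
  obtain ⟨hct, s', hs', a, ha1, ha2⟩ :=
    h.bound c hc fun h0 => hd0 (Prog.psi_eq_zero_of_mem_run h0 hdc)
  have := Prog.haltsWithin_run_of_time (h' s' hs') ha1 ha2 d hdc hd0
  omega

theorem stackFile_append_replicate (L : List (List Bool)) (k : ℕ) :
    stackFile (L ++ List.replicate k []) = stackFile L := by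
  funext r
  rcases lt_or_ge r L.length with hr | hr
  · simp [stackFile, List.getD_eq_getElem?_getD, List.getElem?_append_left hr]
  · rw [stackFile, stackFile, List.getD_append_right _ _ _ _ hr, List.getD_eq_default _ _ hr]
    rw [List.getD_eq_getElem?_getD, List.getElem?_replicate]
    split_ifs <;> rfl

/-- Padding with empty stacks makes the list long enough for `update_stackFile`. -/
theorem Config.init_eq_start (inputs : List (List Bool)) (ψ : QState) (k : ℕ) :
    Config.init inputs ψ =
      MState.start (stackFile ([] :: inputs ++ List.replicate k []), ψ) := by
  rw [stackFile_append_replicate]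
  simp only [Config.init, MState.start, Config.mk.injEq, and_true]
  funext r
  cases r <;> simp [stackFile]

/-- Run the attack `P` if enough indices have been found. -/
def Prog.attackIfReady (P : Prog) : Prog := .cases 10 P .skip .skip

section Tail

variable {G : Generator} {P : Prog} {n p m : ℕ} {J : Finset ℕ} {x : Fin n → Bool}

theorem basesFile_apply_self : basesFile G n x p m J m = (bitMask (8 * p) J).reverse := by
  simp [basesFile]

theorem basesFile_apply_ten (hm : 12 ≤ m) : basesFile G n x p m J 10 = unary (p - J.card) := by
  rw [basesFile, Function.update_of_ne (by omega)]
  simp [stackFile]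

theorem basesFile_apply_zero (hm : 12 ≤ m) : basesFile G n x p m J 0 = [] := by
  rw [basesFile, Function.update_of_ne (by omega)]
  simp [stackFile]

/-- Stack `10` is empty exactly when all bits were found. Apart from one tick and the mask on stack
`m`, which `P` cannot reach, the start is then the initial configuration of the attack, and `P`
ignores the oracle. -/
theorem Prog.run_attackIfReady_of_card_eq (O : List Bool → List Bool) (hP : P.OracleFree)
    (hm : 12 ≤ m) (hPm : P.regBound ≤ m) (hJ : J.card = p) :
    P.attackIfReady.run O (MState.start (basesFile G n x p m J, QState.zero)) =
      (attackRun G P n (8 * p) J x).map (Config.modify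
        (fun r => if r = m then some (bitMask (8 * p) J).reverse else none) 1 1) := by
  have h10 : (MState.start (basesFile G n x p m J, QState.zero)).reg 10 = [] := by
    simp [MState.start, basesFile_apply_ten hm, hJ, unary]
  rw [Prog.attackIfReady, Prog.run, h10, attackRun, ← Prog.run_modify, hP.run_eq O fun _ => []]
  · rw [Config.init_eq_start _ _ 8]
    simp only [Config.modify, Config.tick, MState.start, one_smul]
    congr 2
    funext r
    by_cases hr : r = m
    · subst hr; simp [basesFile]
    · rw [basesFile, Function.update_of_ne hr, if_neg hr, Option.getD_none]
      simp only [hJ, Nat.sub_self]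
      rfl
  · intro r hr
    rw [if_neg (by omega)]

theorem Prog.run_attackIfReady_of_card_lt (O : List Bool → List Bool) (hm : 12 ≤ m)
    (hJ : J.card < p) :
    P.attackIfReady.run O (MState.start (basesFile G n x p m J, QState.zero)) =
      [⟨basesFile G n x p m J, QState.zero, 2⟩] := by
  have h10 : (MState.start (basesFile G n x p m J, QState.zero)).reg 10 =
      true :: unary (p - J.card - 1) := by
    simp only [MState.start, basesFile_apply_ten hm, unary]
    rw [← List.replicate_succ]
    congr 1
    omega
  rw [Prog.attackIfReady, Prog.run, h10]
  simp [Prog.run, Config.tick, MState.start]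

theorem outDist_attackIfReady (O : List Bool → List Bool) (hP : P.OracleFree)
    (hm : 12 ≤ m) (hPm : P.regBound ≤ m) (hJ : J.card ≤ p) :
    outDist (P.attackIfReady.run O (MState.start (basesFile G n x p m J, QState.zero))) =
      attackOrNothing G P n p J x := by
  rcases hJ.lt_or_eq with hJ | hJ
  · rw [Prog.run_attackIfReady_of_card_lt O hm hJ, attackOrNothing, if_pos hJ]
    simp [outDist, basesFile_apply_zero hm]
  · rw [Prog.run_attackIfReady_of_card_eq O hP hm hPm hJ, attackOrNothing, if_neg (by omega),
      outDist_map_modify _ (if_neg (by omega))]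
    simp

theorem reg_of_mem_attackIfReady (O : List Bool → List Bool) (hP : P.OracleFree)
    (hm : 12 ≤ m) (hPm : P.regBound ≤ m) (hJ : J.card ≤ p) {c : Config}
    (hc : c ∈ P.attackIfReady.run O (MState.start (basesFile G n x p m J, QState.zero))) :
    c.reg m = (bitMask (8 * p) J).reverse := by
  rcases hJ.lt_or_eq with hJ | hJ
  · rw [Prog.run_attackIfReady_of_card_lt O hm hJ, List.mem_singleton] at hc
    rw [hc]
    exact basesFile_apply_self
  · rw [Prog.run_attackIfReady_of_card_eq O hP hm hPm hJ] at hc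
    obtain ⟨d, -, rfl⟩ := List.mem_map.1 hc
    simp [Config.modify]

theorem haltsWithin_attackIfReady (O : List Bool → List Bool) (hP : P.OracleFree)
    (hm : 12 ≤ m) (hPm : P.regBound ≤ m) (hJ : J.card ≤ p) {B : ℕ}
    (hB : J.card = p → HaltsWithin (attackRun G P n (8 * p) J x) B) :
    HaltsWithin (P.attackIfReady.run O (MState.start (basesFile G n x p m J, QState.zero)))
      (B + 2) := by
  intro c hc h0
  rcases hJ.lt_or_eq with hJ | hJ
  · rw [Prog.run_attackIfReady_of_card_lt O hm hJ, List.mem_singleton] at hc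
    rw [hc]
    simp
  · rw [Prog.run_attackIfReady_of_card_eq O hP hm hPm hJ] at hc
    obtain ⟨d, hd, rfl⟩ := List.mem_map.1 hc
    have := hB hJ d hd fun hd0 => h0 (by simp [Config.modify, hd0])
    simp only [Config.modify]
    omega

/-- Run the attack and add the set of indices used to the output. -/
def Prog.attackWithMask (P : Prog) (m : ℕ) : Prog :=
  .seq P.attackIfReady (.loop m (.moveOne m 0))

theorem Prog.samples_prepend {O : List Bool → List Bool} {R : ℕ → List Bool} {ψ : QState}
    {l : List Bool} (hm : 12 ≤ m) (hR : R m = l.reverse) :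
    (Prog.loop m (.moveOne m 0)).Samples O (R, ψ)
      (Finsupp.single (Function.update (Function.update R 0 (l ++ R 0)) m [], ψ) 1)
      (l.length * 3 + 1) := by
  have hl : (R m).length = l.length := by simp [hR]
  have := Prog.samples_move (O := O) (ψ := ψ) (R := R) (r := m) (s := 0) (a := m) (k := l.length)
    (by omega) hl hl.ge
  rwa [List.take_of_length_le hl.le, List.drop_eq_nil_of_le hl.le, hR, List.reverse_reverse] at this

/-- Stack `m` has the same content in all branches, so prepending it is a fixed map on outputs and
pushes the distribution forward branch by branch. -/
theorem outDist_attackWithMask (O : List Bool → List Bool) (hP : P.OracleFree)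
    (hm : 12 ≤ m) (hPm : P.regBound ≤ m) (hJ : J.card ≤ p) :
    outDist ((P.attackWithMask m).run O (MState.start (basesFile G n x p m J, QState.zero))) =
      Finsupp.mapDomain (bitMask (8 * p) J ++ ·) (attackOrNothing G P n p J x) := by
  rw [← outDist_attackIfReady O hP hm hPm hJ, Prog.attackWithMask, Prog.run, outDist_flatMap]
  have key : ∀ cs : List Config, (∀ c ∈ cs, c.reg m = (bitMask (8 * p) J).reverse) →
      (cs.map fun c => outDist ((Prog.loop m (.moveOne m 0)).run O c)).sum =
        Finsupp.mapDomain (bitMask (8 * p) J ++ ·) (outDist cs) := by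
    intro cs
    induction cs with
    | nil => intro _; simp [outDist]
    | cons c cs ih =>
      intro hcs
      have h1 := (Prog.samples_prepend (O := O) (ψ := c.psi) hm (hcs c (by simp))).sum
        (fun c => outDist [c]) fun a t c => by
          have := outDist_map_modify (fun _ => none) rfl a t [c]
          simpa using this
      have h2 : ∀ cs : List Config, (cs.map fun c => outDist [c]).sum = outDist cs := fun cs => by
        simp [outDist]
      rw [h2, Finsupp.linearCombination_single, one_smul] at h1
      -- `Samples` speaks about clock 0; the scalar 1 and the shift `c.time` carry the result over
      -- to the branch `c`.
      have h3 := quadratic_outDist_run O (.loop m (.moveOne m 0)) 1 c.time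
        (MState.start (c.reg, c.psi))
      beta_reduce at h3
      rw [← Config.eq_scale_start rfl (by simp), h1] at h3
      rw [List.map_cons, List.sum_cons, h3, ih fun c hc => hcs c (by simp [hc])]
      have h4 : outDist (c :: cs) = outDist [c] + outDist cs := by simp [outDist]
      rw [h4, Finsupp.mapDomain_add]
      have h0 : (0 : ℕ) ≠ m := by omega
      simp [outDist, MState.start, Finsupp.mapDomain_single, Function.update_of_ne h0]
  exact key _ fun c hc => reg_of_mem_attackIfReady O hP hm hPm hJ hc

theorem haltsWithin_attackWithMask (O : List Bool → List Bool) (hP : P.OracleFree)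
    (hm : 12 ≤ m) (hPm : P.regBound ≤ m) (hJ : J.card ≤ p) {B : ℕ}
    (hB : J.card = p → HaltsWithin (attackRun G P n (8 * p) J x) B) :
    HaltsWithin ((P.attackWithMask m).run O (MState.start (basesFile G n x p m J, QState.zero)))
      (B + 2 + (8 * p * 3 + 1)) := by
  intro d hd hd0
  obtain ⟨c, hc, hdc⟩ := List.mem_flatMap.1 hd
  have h1 := haltsWithin_attackIfReady O hP hm hPm hJ hB c hc
    fun h0 => hd0 (Prog.psi_eq_zero_of_mem_run h0 hdc)
  have h2 := Prog.haltsWithin_run_of_time (a := 1) (Prog.samples_prepend (O := O) (ψ := c.psi) hm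
    (reg_of_mem_attackIfReady O hP hm hPm hJ hc)).haltsWithin (c := c) rfl (by simp) d hdc hd0
  rw [bitMask_length] at h2
  omega

end Tail

/-! # The theorem -/

theorem Polynomial.eval_le_eval_of_nat (p : Polynomial ℕ) {a b : ℕ} (h : a ≤ b) :
    p.eval a ≤ p.eval b := by
  rw [Polynomial.eval_eq_sum, Polynomial.eval_eq_sum]
  exact Finset.sum_le_sum fun i _ => Nat.mul_le_mul_left _ (Nat.pow_le_pow_left h i)

/-- The adversary that finds bases and goes on with the program `tail`. -/
theorem exists_eve (G : Generator) (S : HashScheme) (p : Polynomial ℕ) (m : ℕ) (hm : 12 ≤ m) :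
    ∃ (E : Prog → Prog) (q : Polynomial ℕ), ∀ (tail : Prog) (n N : ℕ),
      8 * p.eval n ≤ N * S.tagLen n → ∀ (h : S.Msg n → Fin (S.tagCard n)) (Y : ℕ → S.Msg n) x,
      outDist (eveRun G S (E tail) n N h Y x) = Finsupp.linearCombination ℝ
        (fun J => outDist (tail.run (S.hashOracle n h)
          (MState.start (basesFile G n x (p.eval n) m J, QState.zero))))
        (pickDist (p.eval n) (8 * p.eval n) ∅) ∧
      ∀ B, (∀ J ⊆ Finset.range (8 * p.eval n), J.card ≤ p.eval n →
        HaltsWithin (tail.run (S.hashOracle n h)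
          (MState.start (basesFile G n x (p.eval n) m J, QState.zero))) B) →
        HaltsWithin (eveRun G S (E tail) n N h Y x)
          (q.eval (n + N + S.msgLen n + S.tagLen n) + B) := by
  classical
  obtain ⟨A, qA, hA⟩ := exists_prog_unary_eval (8 * p) 8 (by norm_num)
  obtain ⟨A', qA', hA'⟩ := exists_prog_unary_eval p 10 (by norm_num)
  refine ⟨fun tail => .seq (.findBases A A' m) tail,
    -- Here 52 = 8 + 4 + 40 collects the coefficients of the products of `N` with the message and
    -- tag lengths, and the linear terms sum to at most eight times the total size.
    qA + qA' + 52 * Polynomial.X ^ 2 + 8 * Polynomial.X + 9, ?_⟩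
  intro tail n N hN h Y x
  set s := n + N + S.msgLen n + S.tagLen n with hs
  have hF := Prog.samples_findBases G S n h Y N (p.eval n) x (A := A) (B := A')
    (tA := qA.eval n) (tB := qA'.eval n) (m := m) hN hm
    (fun O R ψ hR => by
      have := hA O R ψ
      rw [hR, Polynomial.eval_mul] at this
      simpa using this)
    (fun O R ψ hR => by simpa [hR] using hA' O R ψ)
  have hrun : eveRun G S (.seq (.findBases A A' m) tail) n N h Y x =
      (Prog.seq (.findBases A A' m) tail).run (S.hashOracle n h) (MState.start
        (stackFile [[], unary n, unary (S.msgLen n), unary (S.tagLen n), unary N,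
          messagesFrom Y N 0, [], [], [], [], [], []],
          codeState (N * S.tagLen n) (G n x) (S.tagStream n h Y))) := by
    rw [eveRun, Config.init_eq_start _ _ 6, messagesFrom, Nat.sub_zero, ← List.range_eq_range']
    rfl
  refine ⟨?_, fun B hB => ?_⟩
  · rw [hrun, Prog.run, outDist_flatMap, hF.sum _ (quadratic_outDist_run _ tail),
      Finsupp.apply_linearCombination]
    congr 2
    funext J
    simp
  · rw [hrun]
    have := hF.haltsWithin_seq (Q := tail) (B' := B) fun s' hs' => by
      rw [Finsupp.linearCombination_apply] at hs'
      obtain ⟨J, hJ, hJs⟩ := Finset.mem_biUnion.1 (Finsupp.support_sum hs')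
      rw [Finset.mem_singleton.1 (Finsupp.support_single_subset (Finsupp.support_smul hJs))]
      obtain ⟨h1, h2⟩ := mem_support_pickDist_empty hJ
      exact hB J h1 h2
    intro c hc h0
    refine (this c hc h0).trans (Nat.add_le_add_right ?_ B)
    have e : (qA + qA' + 52 * Polynomial.X ^ 2 + 8 * Polynomial.X + 9 : Polynomial ℕ).eval s =
        qA.eval s + qA'.eval s + 52 * s ^ 2 + 8 * s + 9 := by
      simp
    rw [e]
    have h1 := Polynomial.eval_le_eval_of_nat qA (show n ≤ s by omega)
    have h2 := Polynomial.eval_le_eval_of_nat qA' (show n ≤ s by omega)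
    have h3 : N * S.msgLen n ≤ s * s := Nat.mul_le_mul (by omega) (by omega)
    have h4 : N * S.tagLen n ≤ s * s := Nat.mul_le_mul (by omega) (by omega)
    have h5 : N * (8 * S.msgLen n + 4 * S.tagLen n + 5) =
        8 * (N * S.msgLen n) + 4 * (N * S.tagLen n) + 5 * N := by ring
    rw [h5, pow_two]
    omega

theorem mainTheorem5 (G : Generator) (S : HashScheme) (p : Polynomial ℕ) :
    (Attackable G p → SeedLeaks G S (fun n => 8 * p.eval n)) ∧
      (SeedComputable G p → SeedRecovered G S (fun n => 8 * p.eval n)) := by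
  constructor
  · rintro ⟨P, q, C, hP, h⟩
    obtain ⟨E, qE, hE⟩ := exists_eve G S p (max 12 P.regBound) (le_max_left _ _)
    -- The given constant could be negative; the estimates need a nonnegative one.
    have hC : C ≤ max C 0 := le_max_left _ _
    have hC0 : 0 ≤ max C 0 := le_max_right _ _
    -- The mask is kept beyond the stacks of both `P` and the adversary, which uses twelve. Writing
    -- its `8 * p` bits to the output, three steps each, accounts for `24 * p`.
    refine ⟨E (P.attackWithMask (max 12 P.regBound)), qE + q + 24 * p + 3, 10 + 21 * max C 0, 1 / 4,
      by norm_num, fun n N hN g _ Y => ⟨fun x => ?_, ?_⟩⟩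
    · have := (hE (P.attackWithMask (max 12 P.regBound)) n N hN g Y x).2
        (q.eval n + 2 + (8 * p.eval n * 3 + 1)) fun J hJ hc =>
          haltsWithin_attackWithMask _ hP (le_max_left _ _) (le_max_right _ _) hc fun hcard =>
            (h n J hJ hcard).1 x
      refine fun c hc h0 => (this c hc h0).trans ?_
      have h1 := Polynomial.eval_le_eval_of_nat q
        (show n ≤ n + N + S.msgLen n + S.tagLen n by omega)
      have h2 := Polynomial.eval_le_eval_of_nat p
        (show n ≤ n + N + S.msgLen n + S.tagLen n by omega)
      simp only [Polynomial.eval_add, Polynomial.eval_mul, Polynomial.eval_ofNat]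
      omega
    · have hI : ∀ I ⊆ Finset.range (8 * p.eval n), I.card = p.eval n →
          condEntropy (fun x => outDist (attackRun G P n (8 * p.eval n) I x)) ≤
            max C 0 * (1 / 2) ^ n := fun I hI hc =>
        (h n I hI hc).2.trans (mul_le_mul_of_nonneg_right hC (by positivity))
      refine le_trans (le_of_eq ?_) ((condEntropy_pick_le hC0 hI).trans
        (mul_fail_le hC0 fun hm => two_pow_le_of_condEntropy_le hm hI))
      congr 1
      funext x
      rw [(hE _ n N hN g Y x).1, Finsupp.linearCombination_apply, Finsupp.linearCombination_apply]
      refine Finset.sum_congr rfl fun J hJ => ?_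
      simp only [outDist_attackWithMask _ hP (le_max_left _ _) (le_max_right _ _)
        (mem_support_pickDist_empty hJ).2]
  · rintro ⟨P, q, C, hP, h⟩
    obtain ⟨E, qE, hE⟩ := exists_eve G S p (max 12 P.regBound) (le_max_left _ _)
    have hC : C ≤ max C 0 := le_max_left _ _
    have hC0 : 0 ≤ max C 0 := le_max_right _ _
    refine ⟨E P.attackIfReady, qE + q + 2, 1 + 3 * max C 0, 1 / 4,
      by norm_num, fun n N hN g _ Y => ⟨fun x => ?_, ?_⟩⟩
    · have := (hE P.attackIfReady n N hN g Y x).2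
        (q.eval n + 2) fun J hJ hc =>
          haltsWithin_attackIfReady _ hP (le_max_left _ _) (le_max_right _ _) hc fun hcard =>
            (h n J hJ hcard).1 x
      refine fun c hc h0 => (this c hc h0).trans ?_
      have h1 := Polynomial.eval_le_eval_of_nat q
        (show n ≤ n + N + S.msgLen n + S.tagLen n by omega)
      simp only [Polynomial.eval_add, Polynomial.eval_ofNat]
      omega
    · have hI : ∀ I ⊆ Finset.range (8 * p.eval n), I.card = p.eval n →
          1 - max C 0 * (1 / 2) ^ n ≤
            guessProb (fun x => outDist (attackRun G P n (8 * p.eval n) I x)) := fun I hI hc =>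
        le_trans (sub_le_sub_left (mul_le_mul_of_nonneg_right hC (by positivity)) 1)
          (h n I hI hc).2
      refine le_trans (sub_le_sub_left
        (fail_le hC0 fun hm => two_pow_le_of_le_guessProb hm hI) 1)
        ((le_guessProb_pick hC0 hI).trans (le_of_eq ?_))
      congr 1
      funext x
      rw [(hE _ n N hN g Y x).1, Finsupp.linearCombination_apply, Finsupp.linearCombination_apply]
      refine Finset.sum_congr rfl fun J hJ => ?_
      simp only [outDist_attackIfReady _ hP (le_max_left _ _) (le_max_right _ _)
        (mem_support_pickDist_empty hJ).2]
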